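/- Let $C_1,C_2,c,a>0$, $\Omega\in\mathbb{R}\setminus\{0\}$ and $X_d=(x_d,y_d)\in\mathbb{R}^2$, and let $J(x,y)=C_1(x-x_d)^4+C_2(y-y_d)^4$. For $\varepsilon>0$ consider the unicycle extremum seeking system without high-pass filter $$\dot x=v\cos(\Omega t),\qquad \dot y=v\sin(\Omega t),\qquad v=2\Big(\frac{2\pi}{\varepsilon}\Big)^{3/4}\Big(3c\,J(x,y)\sin\frac{6\pi t}{\varepsilon}+a\cos\frac{2\pi t}{\varepsilon}\Big).$$ For every compact set $D\subset\mathbb{R}^2$ with $X_d\in D$ this system is practically exponentially stable: there are constants $q_1,q_2>0$, a number $\varepsilon_0>0$ and a function $d$ with $d(\varepsilon)\to0$ as $\varepsilon\to0^+$ such that, for all $\varepsilon\in(0,\varepsilon_0)$, all $X_0\in D$ and all $T>0$, the solution $X(t)=(x(t),y(t))$ with $X(0)=X_0$ exists on $[0,T]$ and satisfies $$\|X(t)-X_d\|\le q_1\,\|X_0-X_d\|\,e^{-q_2t}+d(\varepsilon)\qquad\text{for all }t\in[0,T].$$ Here $q_1,q_2$ do not depend on $\varepsilon$, $X_0$ or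 $T$, and $d$ and $\varepsilon_0$ do not depend on $X_0$ or $T$. -/

import Mathlib

open Filter Topology

noncomputable section

/-- The position plane, with the Euclidean norm. -/
abbrev Plane : Type := EuclideanSpace ℝ (Fin 2)

/-- The objective function `J(x, y) = C₁ (x - x_d)⁴ + C₂ (y - y_d)⁴`. -/
def objective (C₁ C₂ : ℝ) (Xd X : Plane) : ℝ :=
  C₁ * (X 0 - Xd 0) ^ 4 + C₂ * (X 1 - Xd 1) ^ 4

/-- The linear velocity law (third-order dither)
`v = 2 (2π/ε)^(3/4) (3 c J sin(6πt/ε) + a cos(2πt/ε))`, where `J` is the measured value of the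
objective function. -/
def velocityLaw (c a ε t J : ℝ) : ℝ :=
  2 * (2 * Real.pi / ε) ^ (3 / 4 : ℝ) *
    (3 * c * J * Real.sin (6 * Real.pi * t / ε) + a * Real.cos (2 * Real.pi * t / ε))

/-- The right-hand side of the closed-loop unicycle system without high-pass filter:
`x' = v cos(Ωt)`, `y' = v sin(Ωt)`. -/
def unicycleField (C₁ C₂ c a Ω : ℝ) (Xd : Plane) (ε t : ℝ) (X : Plane) : Plane :=
  !₂[velocityLaw c a ε t (objective C₁ C₂ Xd X) * Real.cos (Ω * t),
     velocityLaw c a ε t (objective C₁ C₂ Xd X) * Real.sin (Ω * t)]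

/-- `X` solves `X' = f(t, X)` on `[0, T]` with `X(0) = X₀`. -/
def IsSolution (f : ℝ → Plane → Plane) (X₀ : Plane) (T : ℝ) (X : ℝ → Plane) : Prop :=
  X 0 = X₀ ∧
    ∀ t ∈ Set.Icc (0 : ℝ) T, HasDerivWithinAt X (f t (X t)) (Set.Icc (0 : ℝ) T) t

/-- The family of systems `X' = f ε t X`, `ε > 0`, is practically exponentially stable at `Xd` for
initial positions in `D`. The constants `q₁`, `q₂` do not depend on `ε`, on the initial position or
on the horizon `T`; the residual `d ε` and the threshold `ε₀` do not depend on the initial position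
or on `T`. -/
def IsPracticallyExpStable (f : ℝ → ℝ → Plane → Plane) (Xd : Plane) (D : Set Plane) : Prop :=
  ∃ q₁ > (0 : ℝ), ∃ q₂ > (0 : ℝ), ∃ d : ℝ → ℝ, Tendsto d (𝓝[>] 0) (𝓝 0) ∧
    ∃ ε₀ > (0 : ℝ), ∀ ε ∈ Set.Ioo 0 ε₀, ∀ X₀ ∈ D, ∀ T > (0 : ℝ),
      (∃ X : ℝ → Plane, IsSolution (f ε) X₀ T X) ∧
      ∀ X : ℝ → Plane, IsSolution (f ε) X₀ T X →
        ∀ t ∈ Set.Icc (0 : ℝ) T,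
          ‖X t - Xd‖ ≤ q₁ * ‖X₀ - Xd‖ * Real.exp (-(q₂ * t)) + d ε

end

/-! Put δ = (ε/2π)^(1/4), θ = t/δ⁴, α = 6c, β = 2a and h = (cos Ωt, sin Ωt). The velocity is δ⁻³(α J
sin 3θ + β cos θ). Subtracting δβ sin θ · h from the position removes the β-term and evaluates J at
a point shifted along h, where the Taylor expansion of the quartic J is exact. Among the products of
oscillations that arise up to order δ⁰, only sin³θ sin 3θ has nonzero mean, namely -1/8; it
multiplies the third directional derivative of J, which is linear in the position. All other terms
are removed by a near-identity change of variables (`corrector_hasDeriv`, `exists_near_identity`).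
On bounded sets there remains X' = -λ ℓ h + O(δ), with λ = αβ³/2 and ℓ = C₁ x cos³Ωt + C₂ y sin³Ωt.

The coefficients of ℓ are not parallel to h in general, so the squared norm need not decrease. Let
γᵢ be the cube root of Cᵢ and a, b those of x, y. Then ℓ = A³ + B³ with A = γ₁ a cos Ωt and B = γ₂ b
sin Ωt, and the gauge V of `dualGauge` has gradient 2w(γ₁a, γ₂b), where w² = γ₁a⁴ + γ₂b⁴. Hence V' =
-2λ w (A + B)(A³ + B³), which is at most a negative multiple of ℓ². Since ℓ² has a positive definite
mean over a period of h, a small periodic quadratic correction makes the decay strict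
(`exists_lyapunov`).

The limit is linear, so the decay constants hold on every ball and only the O(δ) constant depends on
its radius (`exists_apriori_estimate`). The radius can therefore be fixed before ε, and a first-exit
argument confines all motions. -/

noncomputable section

/-! ### A Lyapunov gauge of degree two -/

/-- The `3/2`-th power of a weighted `ℓ^(4/3)` gauge on the plane. -/
def dualGauge (γ₁ γ₂ x y : ℝ) : ℝ :=
  (γ₁ * |x| ^ (4 / 3 : ℝ) + γ₂ * |y| ^ (4 / 3 : ℝ)) ^ (3 / 2 : ℝ)

/-- The third clause has the shape in which `hasDerivAt_abs_rpow` gives the derivative, so the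
gradient of the gauge becomes polynomial in cube roots, even where a coordinate vanishes. -/
lemma exists_cbrt (x : ℝ) :
    ∃ a : ℝ, a ^ 3 = x ∧ |x| ^ (4 / 3 : ℝ) = a ^ 4 ∧ |x| ^ (4 / 3 - 2 : ℝ) * x = a := by
  refine ⟨|x| ^ (4 / 3 - 2 : ℝ) * x, ?_, ?_, rfl⟩
  · rcases eq_or_ne x 0 with rfl | hx
    · simp
    have h0 : 0 < |x| := abs_pos.2 hx
    have h1 : (|x| ^ (4 / 3 - 2 : ℝ)) ^ 3 * |x| ^ 2 = 1 := by
      rw [← Real.rpow_natCast, ← Real.rpow_mul h0.le, ← Real.rpow_natCast |x| 2,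
        ← Real.rpow_add h0]
      norm_num
    rw [sq_abs] at h1
    linear_combination x * h1
  · rcases eq_or_ne x 0 with rfl | hx
    · simp
    have h0 : 0 < |x| := abs_pos.2 hx
    have h1 : (|x| ^ (4 / 3 - 2 : ℝ)) ^ 4 * |x| ^ 4 = |x| ^ (4 / 3 : ℝ) := by
      rw [← Real.rpow_natCast, ← Real.rpow_mul h0.le, ← Real.rpow_natCast |x| 4,
        ← Real.rpow_add h0]
      norm_num
    rw [← h1, mul_pow, Even.pow_abs (by decide)]

/-- In terms of the cube roots of the coordinates, `dualGauge` and its derivative along a curve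
are polynomial up to one square root. -/
lemma exists_dualGauge_data {γ₁ γ₂ : ℝ} (h₁ : 0 < γ₁) (h₂ : 0 < γ₂) (x₀ y₀ : ℝ) :
    ∃ a b w : ℝ, a ^ 3 = x₀ ∧ b ^ 3 = y₀ ∧ 0 ≤ w ∧ w ^ 2 = γ₁ * a ^ 4 + γ₂ * b ^ 4 ∧
      dualGauge γ₁ γ₂ x₀ y₀ = w ^ 3 ∧
      ∀ (x y : ℝ → ℝ) (x' y' : ℝ) (S : Set ℝ) (t : ℝ), x t = x₀ → y t = y₀ →
        HasDerivWithinAt x x' S t → HasDerivWithinAt y y' S t →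
        HasDerivWithinAt (fun τ => dualGauge γ₁ γ₂ (x τ) (y τ))
          (2 * w * (γ₁ * a * x' + γ₂ * b * y')) S t := by
  obtain ⟨a, ha, ha4, had⟩ := exists_cbrt x₀
  obtain ⟨b, hb, hb4, hbd⟩ := exists_cbrt y₀
  have hV : 0 ≤ γ₁ * a ^ 4 + γ₂ * b ^ 4 := by positivity
  refine ⟨a, b, √(γ₁ * a ^ 4 + γ₂ * b ^ 4), ha, hb, Real.sqrt_nonneg _, Real.sq_sqrt hV, ?_, ?_⟩
  · rw [dualGauge, ha4, hb4, Real.sqrt_eq_rpow, ← Real.rpow_natCast _ 3, ← Real.rpow_mul hV]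
    norm_num
  · intro x y x' y' S t hx hy hdx hdy
    subst hx hy
    have e1 := (hasDerivAt_abs_rpow (x t) (p := 4 / 3) (by norm_num)).comp_hasDerivWithinAt t hdx
    have e2 := (hasDerivAt_abs_rpow (y t) (p := 4 / 3) (by norm_num)).comp_hasDerivWithinAt t hdy
    have e3 := ((e1.const_mul γ₁).fun_add (e2.const_mul γ₂)).rpow_const (p := 3 / 2)
      (Or.inr (by norm_num))
    refine e3.congr_deriv ?_
    simp only [Function.comp]
    rw [ha4, hb4, mul_assoc (4 / 3 : ℝ) _ (x t), had, mul_assoc (4 / 3 : ℝ) _ (y t), hbd, Real.sqrt_eq_rpow]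
    norm_num
    ring

/-- Each inequality compares quantities of equal degree in (a, b). The first feeds the dissipation
estimate, the next two make the gauge comparable to the squared norm, and the last two bound its
gradient linearly against additive errors. -/
lemma dualGauge_bounds {γ₁ γ₂ : ℝ} (h₁ : 0 < γ₁) (h₂ : 0 < γ₂) :
    ∃ m > 0, ∃ K > 0, ∀ a b w : ℝ, 0 ≤ w → w ^ 2 = γ₁ * a ^ 4 + γ₂ * b ^ 4 →
      m * ((γ₁ * a) ^ 2 + (γ₂ * b) ^ 2) ≤ w ∧
      m * ((a ^ 3) ^ 2 + (b ^ 3) ^ 2) ≤ w ^ 3 ∧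
      w ^ 3 ≤ K * ((a ^ 3) ^ 2 + (b ^ 3) ^ 2) ∧
      |2 * w * (γ₁ * a)| ≤ K * (|a ^ 3| + |b ^ 3|) ∧
      |2 * w * (γ₂ * b)| ≤ K * (|a ^ 3| + |b ^ 3|) := by
  set g := 1 + γ₁ + γ₂ with hg
  have hg1 : 1 < g := by linarith
  -- Small enough for (p + r)² ≤ 2(p² + r²) to give the first bound after squaring; its cube then
  -- yields the second with `m₁`.
  set m₀ := 1 / (1 + 2 * (γ₁ ^ 3 + γ₂ ^ 3)) with hm₀
  have hm₀p : 0 < m₀ := by positivity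
  have hm₀le : 2 * m₀ ^ 2 * (γ₁ ^ 3 + γ₂ ^ 3) ≤ 1 := by
    rw [hm₀]
    have : 0 < γ₁ ^ 3 + γ₂ ^ 3 := by positivity
    field_simp
    nlinarith
  set m₁ := min (m₀ ^ 3 * γ₁ ^ 6) (m₀ ^ 3 * γ₂ ^ 6) with hm₁
  have hm₁p : 0 < m₁ := by positivity
  refine ⟨min m₀ m₁, by positivity, 8 * g ^ 3, by positivity, fun a b w hw hw2 => ?_⟩
  have hab : m₀ * ((γ₁ * a) ^ 2 + (γ₂ * b) ^ 2) ≤ w := by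
    apply abs_le_of_sq_le_sq' _ hw |>.2
    have p1 : 2 * m₀ ^ 2 * γ₁ ^ 3 ≤ 1 := by nlinarith [pow_pos h₂ 3, pow_pos hm₀p 2]
    have p2 : 2 * m₀ ^ 2 * γ₂ ^ 3 ≤ 1 := by nlinarith [pow_pos h₁ 3, pow_pos hm₀p 2]
    have q1 : 2 * m₀ ^ 2 * γ₁ ^ 3 * (γ₁ * a ^ 4) ≤ 1 * (γ₁ * a ^ 4) :=
      mul_le_mul_of_nonneg_right p1 (by positivity)
    have q2 : 2 * m₀ ^ 2 * γ₂ ^ 3 * (γ₂ * b ^ 4) ≤ 1 * (γ₂ * b ^ 4) :=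
      mul_le_mul_of_nonneg_right p2 (by positivity)
    nlinarith [sq_nonneg (m₀ * ((γ₁ * a) ^ 2 - (γ₂ * b) ^ 2))]
  have hwle : w ≤ g * (a ^ 2 + b ^ 2) := by
    apply abs_le_of_sq_le_sq' _ (by positivity) |>.2
    rw [hw2]
    have : γ₁ * a ^ 4 ≤ g ^ 2 * a ^ 4 := by
      apply mul_le_mul_of_nonneg_right _ (by positivity); nlinarith
    have : γ₂ * b ^ 4 ≤ g ^ 2 * b ^ 4 := by
      apply mul_le_mul_of_nonneg_right _ (by positivity); nlinarith
    have : 0 ≤ g ^ 2 * (2 * a ^ 2 * b ^ 2) := by positivity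
    nlinarith
  have key (p r : ℝ) (hp : 0 ≤ p) (hr : 0 ≤ r) : (p ^ 2 + r ^ 2) * p ≤ 2 * (p ^ 3 + r ^ 3) := by
    nlinarith [mul_nonneg (add_nonneg hp hr) (sq_nonneg (p - r)), pow_nonneg hp 3,
      pow_nonneg hr 3, mul_nonneg hp (sq_nonneg (p - r)), mul_nonneg hr (sq_nonneg (p - r))]
  have grad (γ p r : ℝ) (hγ : 0 < γ) (hγg : γ ≤ g) (hp : w ≤ g * (p ^ 2 + r ^ 2)) :
      |2 * w * (γ * p)| ≤ 8 * g ^ 3 * (|p ^ 3| + |r ^ 3|) := by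
    rw [abs_mul, abs_mul, abs_mul, abs_of_nonneg hw, abs_of_pos hγ, abs_pow, abs_pow, abs_two]
    rw [← sq_abs p, ← sq_abs r] at hp
    have k := key |p| |r| (abs_nonneg _) (abs_nonneg _)
    have s1 : 2 * w * (γ * |p|) ≤ 2 * (g * (|p| ^ 2 + |r| ^ 2)) * (g * |p|) := by gcongr
    have s2 : 2 * (g * (|p| ^ 2 + |r| ^ 2)) * (g * |p|) ≤ 2 * g ^ 2 * (2 * (|p| ^ 3 + |r| ^ 3)) := by
      have := mul_le_mul_of_nonneg_left k (by positivity : 0 ≤ 2 * g ^ 2)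
      linarith
    have s3 : g ^ 2 * (|p| ^ 3 + |r| ^ 3) ≤ g ^ 3 * (|p| ^ 3 + |r| ^ 3) := by
      apply mul_le_mul_of_nonneg_right _ (by positivity); nlinarith [sq_nonneg g]
    have s4 : 0 ≤ g ^ 3 * (|p| ^ 3 + |r| ^ 3) := by positivity
    linarith
  refine ⟨?_, ?_, ?_, ?_, ?_⟩
  · exact (mul_le_mul_of_nonneg_right (min_le_left _ _) (by positivity)).trans hab
  · have c1 : (m₀ * ((γ₁ * a) ^ 2 + (γ₂ * b) ^ 2)) ^ 3 ≤ w ^ 3 := by gcongr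
    refine le_trans ?_ c1
    have d0 : min m₀ m₁ ≤ m₁ := min_le_right _ _
    have d1 : min m₀ m₁ * (a ^ 3) ^ 2 ≤ m₀ ^ 3 * γ₁ ^ 6 * (a ^ 3) ^ 2 :=
      mul_le_mul_of_nonneg_right (d0.trans (min_le_left _ _)) (by positivity)
    have d2 : min m₀ m₁ * (b ^ 3) ^ 2 ≤ m₀ ^ 3 * γ₂ ^ 6 * (b ^ 3) ^ 2 :=
      mul_le_mul_of_nonneg_right (d0.trans (min_le_right _ _)) (by positivity)
    have d3 : 0 ≤ m₀ ^ 3 * (3 * ((γ₁ * a) ^ 2) ^ 2 * (γ₂ * b) ^ 2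
      + 3 * (γ₁ * a) ^ 2 * ((γ₂ * b) ^ 2) ^ 2) := by positivity
    nlinarith
  · have c1 : w ^ 3 ≤ (g * (a ^ 2 + b ^ 2)) ^ 3 := by gcongr
    refine c1.trans ?_
    have : (a ^ 2 + b ^ 2) ^ 3 ≤ 4 * ((a ^ 2) ^ 3 + (b ^ 2) ^ 3) := by
      nlinarith [mul_nonneg (add_nonneg (sq_nonneg a) (sq_nonneg b)) (sq_nonneg (a ^ 2 - b ^ 2))]
    have := mul_le_mul_of_nonneg_left this (by positivity : 0 ≤ g ^ 3)
    have : 0 ≤ g ^ 3 * ((a ^ 2) ^ 3 + (b ^ 2) ^ 3) := by positivity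
    nlinarith
  · exact grad γ₁ a b h₁ (by linarith) hwle
  · have := grad γ₂ b a h₂ (by linarith) (by rw [add_comm]; exact hwle)
    rwa [add_comm |b ^ 3|] at this

/-! ### Persistent excitation and the strict Lyapunov function -/

/-- The rotating linear functional `(x, y) ↦ C₁ x cos³(Ωt) + C₂ y sin³(Ωt)`. -/
def rotatingForm (C₁ C₂ Ω t x y : ℝ) : ℝ :=
  C₁ * Real.cos (Ω * t) ^ 3 * x + C₂ * Real.sin (Ω * t) ^ 3 * y

lemma hasDerivAt_cos_mul (Ω t : ℝ) :
    HasDerivAt (fun τ => Real.cos (Ω * τ)) (-(Ω * Real.sin (Ω * t))) t := by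
  have := ((hasDerivAt_id t).const_mul Ω).cos
  refine this.congr_deriv ?_
  simp; ring

lemma hasDerivAt_sin_mul (Ω t : ℝ) :
    HasDerivAt (fun τ => Real.sin (Ω * τ)) (Ω * Real.cos (Ω * t)) t := by
  have := ((hasDerivAt_id t).const_mul Ω).sin
  refine this.congr_deriv ?_
  simp; ring

/-- The mean of cos⁶ and of sin⁶ is 5/16 and that of cos³ sin³ is 0, so the coefficients of ℓ² minus
its mean have bounded primitives. -/
lemma exists_excitation_primitive (C₁ C₂ Ω : ℝ) (hΩ : Ω ≠ 0) :
    ∃ S₁ S₁₂ S₂ : ℝ → ℝ, ∃ K > 0, (∀ t, |S₁ t| ≤ K ∧ |S₁₂ t| ≤ K ∧ |S₂ t| ≤ K) ∧ ∀ t,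
      HasDerivAt S₁ (C₁ ^ 2 * (Real.cos (Ω * t) ^ 6 - 5 / 16)) t ∧
      HasDerivAt S₁₂ (C₁ * C₂ * (Real.cos (Ω * t) ^ 3 * Real.sin (Ω * t) ^ 3)) t ∧
      HasDerivAt S₂ (C₂ ^ 2 * (Real.sin (Ω * t) ^ 6 - 5 / 16)) t := by
  -- Periodic part of the reduction formula for ∫cos⁶; exchanging sine and cosine and changing sign
  -- gives that of ∫sin⁶.
  let F : ℝ → ℝ → ℝ := fun c s => s * c * (c ^ 4 / 6 + 5 * c ^ 2 / 24 + 5 / 16)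
  let G : ℝ → ℝ := fun s => s ^ 4 / 4 - s ^ 6 / 6
  have hF (c s : ℝ) (hc : |c| ≤ 1) (hs : |s| ≤ 1) : |F c s| ≤ 1 := by
    have hc2 : c ^ 2 ≤ 1 := by rwa [sq_le_one_iff_abs_le_one]
    have h1 : |s * c| ≤ 1 := by
      rw [abs_mul]; exact mul_le_one₀ hs (abs_nonneg _) hc
    have h2 : |c ^ 4 / 6 + 5 * c ^ 2 / 24 + 5 / 16| ≤ 1 := by
      rw [abs_le]; constructor <;> nlinarith [sq_nonneg c]
    show |s * c * (c ^ 4 / 6 + 5 * c ^ 2 / 24 + 5 / 16)| ≤ 1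
    rw [abs_mul]
    exact mul_le_one₀ h1 (abs_nonneg _) h2
  have hG (s : ℝ) (hs : |s| ≤ 1) : |G s| ≤ 1 := by
    have h2 : s ^ 2 ≤ 1 := by rwa [sq_le_one_iff_abs_le_one]
    have h4 : s ^ 4 ≤ 1 := by nlinarith [sq_nonneg s]
    have h6 : s ^ 6 ≤ 1 := by nlinarith [sq_nonneg s, sq_nonneg (s ^ 2)]
    have : 0 ≤ s ^ 4 := by positivity
    have : 0 ≤ s ^ 6 := by positivity
    show |s ^ 4 / 4 - s ^ 6 / 6| ≤ 1
    rw [abs_le]; constructor <;> linarith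
  have bd (A f : ℝ) (hA : A ^ 2 ≤ (C₁ ^ 2 + C₂ ^ 2) ^ 2) (hf : |f| ≤ 1) :
      |A / Ω * f| ≤ (C₁ ^ 2 + C₂ ^ 2 + 1) / |Ω| := by
    rw [abs_mul, abs_div]
    have hA' : |A| ≤ C₁ ^ 2 + C₂ ^ 2 := abs_le_of_sq_le_sq hA (by positivity)
    have : |A| / |Ω| ≤ (C₁ ^ 2 + C₂ ^ 2 + 1) / |Ω| := by gcongr; linarith
    calc |A| / |Ω| * |f| ≤ |A| / |Ω| * 1 := by gcongr
      _ ≤ _ := by rwa [mul_one]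
  refine ⟨fun t => C₁ ^ 2 / Ω * F (Real.cos (Ω * t)) (Real.sin (Ω * t)),
    fun t => C₁ * C₂ / Ω * G (Real.sin (Ω * t)),
    fun t => C₂ ^ 2 / Ω * (-F (Real.sin (Ω * t)) (Real.cos (Ω * t))),
    (C₁ ^ 2 + C₂ ^ 2 + 1) / |Ω|, by positivity, fun t => ⟨?_, ?_, ?_⟩, fun t => ⟨?_, ?_, ?_⟩⟩
  · exact bd _ _ (by gcongr; nlinarith [sq_nonneg C₂])
      (hF _ _ (Real.abs_cos_le_one _) (Real.abs_sin_le_one _))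
  · exact bd _ _ (by nlinarith [sq_nonneg (C₁ ^ 2), sq_nonneg (C₂ ^ 2), sq_nonneg (C₁ * C₂)])
      (hG _ (Real.abs_sin_le_one _))
  · exact bd _ _ (by gcongr; nlinarith [sq_nonneg C₁])
      (by rw [abs_neg]; exact hF _ _ (Real.abs_sin_le_one _) (Real.abs_cos_le_one _))
  all_goals
    have hc := hasDerivAt_cos_mul Ω t
    have hs := hasDerivAt_sin_mul Ω t
    have id := Real.sin_sq_add_cos_sq (Ω * t)
  · have h := ((hs.fun_mul hc).fun_mul ((((hc.fun_pow 4).div_const 6).fun_add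
      (((hc.fun_pow 2).const_mul 5).div_const 24)).add_const (5 / 16))).const_mul (C₁ ^ 2 / Ω)
    refine h.congr_deriv ?_
    field_simp
    set c := Real.cos (Ω * t)
    set s := Real.sin (Ω * t)
    push_cast
    have e : s ^ 2 = 1 - c ^ 2 := by linarith
    ring_nf
    simp only [e]
    ring
  · have h := (((hs.fun_pow 4).div_const 4).fun_sub ((hs.fun_pow 6).div_const 6)).const_mul
      (C₁ * C₂ / Ω)
    refine h.congr_deriv ?_
    field_simp
    set c := Real.cos (Ω * t)
    set s := Real.sin (Ω * t)
    push_cast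
    have e : c ^ 3 = c * (1 - s ^ 2) := by rw [← id]; ring
    rw [e]
    ring
  · have h := (((hc.fun_mul hs).fun_mul ((((hs.fun_pow 4).div_const 6).fun_add
      (((hs.fun_pow 2).const_mul 5).div_const 24)).add_const (5 / 16))).fun_neg).const_mul
      (C₂ ^ 2 / Ω)
    refine h.congr_deriv ?_
    field_simp
    set c := Real.cos (Ω * t)
    set s := Real.sin (Ω * t)
    push_cast
    have e : c ^ 2 = 1 - s ^ 2 := by linarith
    ring_nf
    simp only [e]
    ring

set_option maxHeartbeats 1000000 in
/-- The averaged linear system `(x, y)' = -lam · rotatingForm · (cos Ωt, sin Ωt)` has a strict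
Lyapunov function comparable to the squared norm, robust under additive errors. -/
theorem exists_lyapunov {C₁ C₂ lam Ω : ℝ} (hC₁ : 0 < C₁) (hC₂ : 0 < C₂) (hlam : 0 < lam)
    (hΩ : Ω ≠ 0) :
    ∃ U : ℝ → ℝ → ℝ → ℝ, ∃ m > 0, ∃ M > 0, ∃ q > 0, ∃ K > 0,
      (∀ t x y, m * (x ^ 2 + y ^ 2) ≤ U t x y ∧ U t x y ≤ M * (x ^ 2 + y ^ 2)) ∧
      ∀ (x y : ℝ → ℝ) (S : Set ℝ) (t e₁ e₂ η : ℝ), |e₁| ≤ η → |e₂| ≤ η →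
        HasDerivWithinAt x
          (-(lam * rotatingForm C₁ C₂ Ω t (x t) (y t) * Real.cos (Ω * t)) + e₁) S t →
        HasDerivWithinAt y
          (-(lam * rotatingForm C₁ C₂ Ω t (x t) (y t) * Real.sin (Ω * t)) + e₂) S t →
        ∃ D, HasDerivWithinAt (fun τ => U τ (x τ) (y τ)) D S t ∧
          D ≤ -q * U t (x t) (y t) + K * η ^ 2 := by
  obtain ⟨γ₁, hγ₁, rfl⟩ : ∃ γ > 0, γ ^ 3 = C₁ :=
    ⟨C₁ ^ (1 / 3 : ℝ), by positivity, by
      rw [← Real.rpow_natCast, ← Real.rpow_mul hC₁.le]; norm_num⟩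
  obtain ⟨γ₂, hγ₂, rfl⟩ : ∃ γ > 0, γ ^ 3 = C₂ :=
    ⟨C₂ ^ (1 / 3 : ℝ), by positivity, by
      rw [← Real.rpow_natCast, ← Real.rpow_mul hC₂.le]; norm_num⟩
  obtain ⟨m₀, hm₀, K₀, hK₀, hg⟩ := dualGauge_bounds hγ₁ hγ₂
  obtain ⟨S₁, S₁₂, S₂, K₁, hK₁, hSb, hSd⟩ :=
    exists_excitation_primitive (γ₁ ^ 3) (γ₂ ^ 3) Ω hΩ
  set ν := 5 / 16 * min ((γ₁ ^ 3) ^ 2) ((γ₂ ^ 3) ^ 2) with hν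
  have hνp : 0 < ν := by positivity
  -- The first bound lets the gauge's dissipation 4λm₀/3 · ℓ² absorb every ℓ² term of the
  -- correction; the second keeps the correction below half the lower bound of the gauge.
  set μ := min (4 * lam * m₀ / 3 / (1 + 16 * lam ^ 2 * K₁ ^ 2 / ν)) (m₀ / (4 * K₁)) with hμ
  have hμp : 0 < μ := by positivity
  have hμ1 : μ * (1 + 16 * lam ^ 2 * K₁ ^ 2 / ν) ≤ 4 * lam * m₀ / 3 := by
    rw [← le_div_iff₀ (by positivity)]; exact min_le_left _ _
  have hμ2 : μ * K₁ ≤ m₀ / 4 := by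
    have : μ ≤ m₀ / (4 * K₁) := min_le_right _ _
    rw [le_div_iff₀ (by positivity)] at this
    linarith
  have hQ (t x y : ℝ) :
      |μ * (S₁ t * x ^ 2 + 2 * S₁₂ t * (x * y) + S₂ t * y ^ 2)| ≤ m₀ / 2 * (x ^ 2 + y ^ 2) := by
    obtain ⟨b1, b2, b3⟩ := hSb t
    have a1 : |S₁ t * x ^ 2| ≤ K₁ * x ^ 2 := by
      rw [abs_mul, abs_of_nonneg (sq_nonneg x)]; gcongr
    have a3 : |S₂ t * y ^ 2| ≤ K₁ * y ^ 2 := by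
      rw [abs_mul, abs_of_nonneg (sq_nonneg y)]; gcongr
    have a2 : |2 * S₁₂ t * (x * y)| ≤ K₁ * (x ^ 2 + y ^ 2) := by
      have : |2 * (x * y)| ≤ x ^ 2 + y ^ 2 := by
        rw [abs_le]; constructor <;> nlinarith [sq_nonneg (x + y), sq_nonneg (x - y)]
      calc |2 * S₁₂ t * (x * y)| = |S₁₂ t| * |2 * (x * y)| := by rw [← abs_mul]; ring_nf
        _ ≤ _ := by gcongr
    rw [abs_mul, abs_of_pos hμp]
    calc μ * |S₁ t * x ^ 2 + 2 * S₁₂ t * (x * y) + S₂ t * y ^ 2|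
        ≤ μ * (K₁ * x ^ 2 + K₁ * (x ^ 2 + y ^ 2) + K₁ * y ^ 2) := by
          gcongr
          exact (abs_add_le _ _).trans (add_le_add ((abs_add_le _ _).trans (add_le_add a1 a2)) a3)
      _ = (μ * K₁) * (2 * (x ^ 2 + y ^ 2)) := by ring
      _ ≤ m₀ / 4 * (2 * (x ^ 2 + y ^ 2)) := by gcongr
      _ = _ := by ring
  set M := K₀ + m₀ with hM
  have hMp : 0 < M := by positivity
  set K₂ := K₀ + 4 * μ * K₁ with hK₂
  have hK₂p : 0 < K₂ := by positivity
  have hUb : ∀ t x y, m₀ / 2 * (x ^ 2 + y ^ 2) ≤ dualGauge γ₁ γ₂ x y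
        + μ * (S₁ t * x ^ 2 + 2 * S₁₂ t * (x * y) + S₂ t * y ^ 2) ∧
      dualGauge γ₁ γ₂ x y + μ * (S₁ t * x ^ 2 + 2 * S₁₂ t * (x * y) + S₂ t * y ^ 2)
        ≤ M * (x ^ 2 + y ^ 2) := by
    intro t x y
    obtain ⟨a, b, w, rfl, rfl, hw, hw2, hU, -⟩ := exists_dualGauge_data hγ₁ hγ₂ x y
    obtain ⟨-, g1, g2, -, -⟩ := hg a b w hw hw2
    have := abs_le.1 (hQ t (a ^ 3) (b ^ 3))
    have h0 : 0 ≤ m₀ * ((a ^ 3) ^ 2 + (b ^ 3) ^ 2) := by positivity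
    rw [hU]
    constructor <;> linarith
  refine ⟨fun t x y => dualGauge γ₁ γ₂ x y
      + μ * (S₁ t * x ^ 2 + 2 * S₁₂ t * (x * y) + S₂ t * y ^ 2),
    m₀ / 2, by positivity, M, by positivity, μ * ν / (8 * M), by positivity,
    16 * K₂ ^ 2 / (μ * ν), by positivity, hUb, ?_⟩
  intro x y S t e₁ e₂ η he₁ he₂ hx hy
  obtain ⟨a, b, w, ha, hb, hw, hw2, hU, hd⟩ := exists_dualGauge_data hγ₁ hγ₂ (x t) (y t)
  obtain ⟨g0, g1, g2, g3, g4⟩ := hg a b w hw hw2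
  obtain ⟨d1, d12, d2⟩ := hSd t
  set c := Real.cos (Ω * t) with hc
  set s := Real.sin (Ω * t) with hs
  set h := rotatingForm (γ₁ ^ 3) (γ₂ ^ 3) Ω t (x t) (y t) with hh
  have hcs : c ^ 2 ≤ 1 ∧ s ^ 2 ≤ 1 := ⟨Real.cos_sq_le_one _, Real.sin_sq_le_one _⟩
  have hform : h = (γ₁ * a * c) ^ 3 + (γ₂ * b * s) ^ 3 := by
    rw [hh, rotatingForm, ← ha, ← hb]; ring
  have hform' : h = γ₁ ^ 3 * c ^ 3 * x t + γ₂ ^ 3 * s ^ 3 * y t := rfl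
  have D1 := hd x y _ _ S t rfl rfl hx hy
  have D2 := ((((d1.hasDerivWithinAt (s := S)).fun_mul (hx.fun_pow 2)).fun_add
    (((d12.hasDerivWithinAt (s := S)).const_mul 2).fun_mul (hx.fun_mul hy))).fun_add
    ((d2.hasDerivWithinAt (s := S)).fun_mul (hy.fun_pow 2))).const_mul μ
  refine ⟨_, D1.fun_add D2, ?_⟩
  have hUt := (hUb t (x t) (y t)).2
  beta_reduce
  set U := dualGauge γ₁ γ₂ (x t) (y t)
      + μ * (S₁ t * x t ^ 2 + 2 * S₁₂ t * (x t * y t) + S₂ t * y t ^ 2) with hUdef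
  set n := |x t| + |y t| with hn
  have hn0 : 0 ≤ n := by positivity
  have hxn : |x t| ≤ n := by linarith only [abs_nonneg (y t), hn]
  have hyn : |y t| ≤ n := by linarith only [abs_nonneg (x t), hn]
  have hn2 : n ^ 2 ≤ 2 * (x t ^ 2 + y t ^ 2) := by
    rw [← sq_abs (x t), ← sq_abs (y t)]
    nlinarith only [sq_nonneg (|x t| - |y t|)]
  obtain ⟨b1, b12, b2⟩ := hSb t
  have hP1 : |S₁ t * x t + S₁₂ t * y t| ≤ K₁ * n := by
    calc _ ≤ |S₁ t| * |x t| + |S₁₂ t| * |y t| := by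
          rw [← abs_mul, ← abs_mul]; exact abs_add_le _ _
      _ ≤ K₁ * |x t| + K₁ * |y t| := by gcongr
      _ = _ := by ring
  have hP2 : |S₁₂ t * x t + S₂ t * y t| ≤ K₁ * n := by
    calc _ ≤ |S₁₂ t| * |x t| + |S₂ t| * |y t| := by
          rw [← abs_mul, ← abs_mul]; exact abs_add_le _ _
      _ ≤ K₁ * |x t| + K₁ * |y t| := by gcongr
      _ = _ := by ring
  set P₁ := S₁ t * x t + S₁₂ t * y t with hP₁
  set P₂ := S₁₂ t * x t + S₂ t * y t with hP₂
  have hη : 0 ≤ η := (abs_nonneg _).trans he₁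
  -- the dissipation controls the square of the rotating form
  have diss : 2 / 3 * m₀ * h ^ 2 ≤ w * (γ₁ * a * c + γ₂ * b * s) * h := by
    set A := γ₁ * a * c
    set B := γ₂ * b * s
    have hA : A ^ 2 ≤ (γ₁ * a) ^ 2 := by
      show (γ₁ * a * c) ^ 2 ≤ _
      rw [mul_pow]; exact mul_le_of_le_one_right (sq_nonneg _) hcs.1
    have hB : B ^ 2 ≤ (γ₂ * b) ^ 2 := by
      show (γ₂ * b * s) ^ 2 ≤ _
      rw [mul_pow]; exact mul_le_of_le_one_right (sq_nonneg _) hcs.2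
    have hAB : 2 / 3 * m₀ * (A ^ 2 - A * B + B ^ 2) ≤ w := by
      refine le_trans ?_ g0
      have : 2 / 3 * (A ^ 2 - A * B + B ^ 2) ≤ (γ₁ * a) ^ 2 + (γ₂ * b) ^ 2 := by
        nlinarith only [sq_nonneg (A + B), hA, hB]
      linarith only [mul_le_mul_of_nonneg_left this hm₀.le]
    have hpos : 0 ≤ (A + B) * h := by
      rw [hform]
      have : (A + B) * (A ^ 3 + B ^ 3) = (A + B) ^ 2 * ((A - B / 2) ^ 2 + 3 / 4 * B ^ 2) := by ring
      rw [this]; positivity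
    calc 2 / 3 * m₀ * h ^ 2 = 2 / 3 * m₀ * (A ^ 2 - A * B + B ^ 2) * ((A + B) * h) := by
          rw [hform]; ring
      _ ≤ w * ((A + B) * h) := mul_le_mul_of_nonneg_right hAB hpos
      _ = _ := by ring
  have err1 : 2 * w * (γ₁ * a) * e₁ + 2 * w * (γ₂ * b) * e₂ ≤ 2 * K₀ * n * η := by
    rw [ha, hb] at g3 g4
    have i1 : |2 * w * (γ₁ * a) * e₁| ≤ K₀ * n * η := by rw [abs_mul]; gcongr
    have i2 : |2 * w * (γ₂ * b) * e₂| ≤ K₀ * n * η := by rw [abs_mul]; gcongr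
    linarith only [i1, i2, le_abs_self (2 * w * (γ₁ * a) * e₁),
      le_abs_self (2 * w * (γ₂ * b) * e₂)]
  have err2 : 2 * (P₁ * e₁ + P₂ * e₂) ≤ 4 * K₁ * n * η := by
    have i1 : |P₁ * e₁| ≤ K₁ * n * η := by rw [abs_mul]; gcongr
    have i2 : |P₂ * e₂| ≤ K₁ * n * η := by rw [abs_mul]; gcongr
    linarith only [i1, i2, le_abs_self (P₁ * e₁), le_abs_self (P₂ * e₂)]
  have cross : -(2 * lam * h * (P₁ * c + P₂ * s)) ≤ ν / 4 * n ^ 2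
      + 16 * lam ^ 2 * K₁ ^ 2 / ν * h ^ 2 := by
    have hc1 : |c| ≤ 1 := Real.abs_cos_le_one _
    have hs1 : |s| ≤ 1 := Real.abs_sin_le_one _
    have i1 : |P₁ * c| ≤ K₁ * n := by
      rw [abs_mul]; exact (mul_le_of_le_one_right (abs_nonneg _) hc1).trans hP1
    have i2 : |P₂ * s| ≤ K₁ * n := by
      rw [abs_mul]; exact (mul_le_of_le_one_right (abs_nonneg _) hs1).trans hP2
    have i3 : |P₁ * c + P₂ * s| ≤ 2 * K₁ * n := (abs_add_le _ _).trans (by linarith only [i1, i2])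
    have i4 : -(2 * lam * h * (P₁ * c + P₂ * s)) ≤ 4 * lam * K₁ * |h| * n := by
      refine (neg_le_abs _).trans ?_
      rw [abs_mul, abs_mul, abs_of_pos (by positivity : 0 < 2 * lam)]
      calc 2 * lam * |h| * |P₁ * c + P₂ * s| ≤ 2 * lam * |h| * (2 * K₁ * n) := by gcongr
        _ = _ := by ring
    refine i4.trans ?_
    have : ν / 4 * n ^ 2 + 16 * lam ^ 2 * K₁ ^ 2 / ν * h ^ 2 - 4 * lam * K₁ * |h| * n
        = (ν / 2 * n - 4 * lam * K₁ * |h|) ^ 2 / ν := by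
      rw [← sq_abs h]; field_simp; ring
    have h0 : 0 ≤ (ν / 2 * n - 4 * lam * K₁ * |h|) ^ 2 / ν := by positivity
    linarith only [this, h0]
  -- The budget in units of μνn²: the mean of ℓ² supplies 1/2, `cross` uses 1/4, `young` uses 1/8
  -- for the errors, and the last 1/8 is the decay rate in `hnU`.
  have low : ν / 2 * n ^ 2 ≤ 5 / 16 * ((γ₁ ^ 3) ^ 2 * x t ^ 2 + (γ₂ ^ 3) ^ 2 * y t ^ 2) := by
    have l1 : ν * x t ^ 2 ≤ 5 / 16 * (γ₁ ^ 3) ^ 2 * x t ^ 2 := by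
      exact mul_le_mul_of_nonneg_right
        (mul_le_mul_of_nonneg_left (min_le_left _ _) (by norm_num)) (sq_nonneg _)
    have l2 : ν * y t ^ 2 ≤ 5 / 16 * (γ₂ ^ 3) ^ 2 * y t ^ 2 := by
      exact mul_le_mul_of_nonneg_right
        (mul_le_mul_of_nonneg_left (min_le_right _ _) (by norm_num)) (sq_nonneg _)
    linarith only [l1, l2, mul_le_mul_of_nonneg_left hn2 hνp.le]
  have young : 2 * K₂ * n * η ≤ μ * ν / 8 * n ^ 2 + 16 * K₂ ^ 2 / (μ * ν) * η ^ 2 := by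
    have : μ * ν / 8 * n ^ 2 + 16 * K₂ ^ 2 / (μ * ν) * η ^ 2 - 2 * K₂ * n * η
        = ((μ * ν * n - 8 * K₂ * η) ^ 2 + 64 * K₂ ^ 2 * η ^ 2) / (8 * (μ * ν)) := by
      field_simp; ring
    have h0 : 0 ≤ ((μ * ν * n - 8 * K₂ * η) ^ 2 + 64 * K₂ ^ 2 * η ^ 2) / (8 * (μ * ν)) := by
      positivity
    linarith only [this, h0]
  have hnU : μ * ν / (8 * M) * U ≤ μ * ν / 8 * n ^ 2 := by
    have : x t ^ 2 + y t ^ 2 ≤ n ^ 2 := by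
      rw [← sq_abs (x t), ← sq_abs (y t), hn]
      linarith only [mul_nonneg (abs_nonneg (x t)) (abs_nonneg (y t)),
        add_pow_two |x t| |y t|]
    calc μ * ν / (8 * M) * U ≤ μ * ν / (8 * M) * (M * n ^ 2) := by
          gcongr; exact hUt.trans (by gcongr)
      _ = _ := by field_simp
  have expand : 2 * w * (γ₁ * a * (-(lam * h * c) + e₁) + γ₂ * b * (-(lam * h * s) + e₂))
      = -(2 * lam) * (w * (γ₁ * a * c + γ₂ * b * s) * h)
        + (2 * w * (γ₁ * a) * e₁ + 2 * w * (γ₂ * b) * e₂) := by ring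
  have quad : (γ₁ ^ 3) ^ 2 * c ^ 6 * x t ^ 2 + 2 * (γ₁ ^ 3 * γ₂ ^ 3 * (c ^ 3 * s ^ 3)) * (x t * y t)
      + (γ₂ ^ 3) ^ 2 * s ^ 6 * y t ^ 2 = h ^ 2 := by rw [hform']; ring
  have m1 := mul_le_mul_of_nonneg_left cross hμp.le
  have m2 := mul_le_mul_of_nonneg_left low hμp.le
  have m3 := mul_le_mul_of_nonneg_left err2 hμp.le
  have m4 := mul_le_mul_of_nonneg_left diss (by positivity : 0 ≤ 2 * lam)
  have m5 := mul_le_mul_of_nonneg_right hμ1 (sq_nonneg h)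
  have hexp2 : μ * ((γ₁ ^ 3) ^ 2 * (c ^ 6 - 5 / 16) * x t ^ 2
        + S₁ t * (↑2 * x t ^ (2 - 1) * (-(lam * h * c) + e₁))
        + (2 * (γ₁ ^ 3 * γ₂ ^ 3 * (c ^ 3 * s ^ 3)) * (x t * y t)
          + 2 * S₁₂ t * ((-(lam * h * c) + e₁) * y t + x t * (-(lam * h * s) + e₂)))
        + ((γ₂ ^ 3) ^ 2 * (s ^ 6 - 5 / 16) * y t ^ 2
          + S₂ t * (↑2 * y t ^ (2 - 1) * (-(lam * h * s) + e₂))))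
      = μ * h ^ 2 - μ * (5 / 16 * ((γ₁ ^ 3) ^ 2 * x t ^ 2 + (γ₂ ^ 3) ^ 2 * y t ^ 2))
        + μ * (-(2 * lam * h * (P₁ * c + P₂ * s))) + μ * (2 * (P₁ * e₁ + P₂ * e₂)) := by
    rw [← quad, hP₁, hP₂]; ring
  have e2 : 2 * K₂ * n * η = 2 * K₀ * n * η + 8 * (μ * K₁) * n * η := by rw [hK₂]; ring
  have p0 : 0 ≤ μ * K₁ * n * η := by positivity
  have p1 : 0 ≤ μ * ν * n ^ 2 := by positivity
  have hfin := add_le_add (le_of_eq expand) (le_of_eq hexp2)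
  push_cast at hfin ⊢
  refine hfin.trans ?_
  linarith only [m1, m2, m3, m4, m5, err1, young, hnU, e2, p0, p1]

/-! ### Fast oscillations and their primitives -/

/-- Values of the oscillating functions of the fast phase `θ` that enter the near-identity
transformation: `sin θ`, `sin 3θ`, `cos 3θ` and the primitives of the zero-mean products. -/
structure Osc where
  s : ℝ
  s3 : ℝ
  c3 : ℝ
  P₁ : ℝ
  P₂ : ℝ
  P₃ : ℝ
  Q₁ : ℝ
  Q₂ : ℝ
  R₁ : ℝ
  R₂ : ℝ
  R₃ : ℝ
  T₁ : ℝ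
  T₂ : ℝ
  T₃ : ℝ

/-- The oscillating functions as polynomials in `s = sin θ` and `k = cos θ`. -/
def oscOf (s k : ℝ) : Osc where
  s := s
  s3 := 3 * s - 4 * s ^ 3
  c3 := k * (1 - 4 * s ^ 2)
  P₁ := s ^ 3 * k
  P₂ := k - 5 / 3 * k ^ 3 + 4 / 5 * k ^ 5
  P₃ := k * (s / 8 + s ^ 3 / 12 + 2 / 3 * s ^ 5)
  Q₁ := s ^ 3 - 16 / 5 * s ^ 5 + 16 / 7 * s ^ 7
  Q₂ := 3 / 5 * s ^ 5 - 4 / 7 * s ^ 7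
  R₁ := 3 / 4 * s ^ 4 - 8 / 3 * s ^ 6 + 2 * s ^ 8
  R₂ := s ^ 6 / 2 - s ^ 8 / 2
  R₃ := k ^ 2 / 2 - 17 / 12 * k ^ 4 + 112 / 90 * k ^ 6 - 2 / 5 * k ^ 8
  T₁ := k * (s ^ 3 - 27 / 5 * s ^ 5 + 54 / 5 * s ^ 7 - 32 / 5 * s ^ 9)
  T₂ := k * (3 / 5 * s ^ 5 - 10 / 7 * s ^ 7 + 32 / 35 * s ^ 9)
  T₃ := k * (9 / 35 * s ^ 7 - 8 / 35 * s ^ 9)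

/-- `o` has the derivatives of the oscillating functions at phase velocity `ω`. -/
structure Osc.HasDeriv (o : ℝ → Osc) (ω : ℝ) (S : Set ℝ) (t : ℝ) : Prop where
  c3 : HasDerivWithinAt (fun τ => (o τ).c3) (ω * (-3 * (o t).s3)) S t
  P₁ : HasDerivWithinAt (fun τ => (o τ).P₁) (ω * ((o t).s * (o t).s3)) S t
  P₂ : HasDerivWithinAt (fun τ => (o τ).P₂) (ω * ((o t).s ^ 2 * (o t).s3)) S t
  P₃ : HasDerivWithinAt (fun τ => (o τ).P₃) (ω * ((o t).s ^ 3 * (o t).s3 + 1 / 8)) S t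
  Q₁ : HasDerivWithinAt (fun τ => (o τ).Q₁) (ω * ((o t).c3 * (o t).s * (o t).s3)) S t
  Q₂ : HasDerivWithinAt (fun τ => (o τ).Q₂) (ω * ((o t).P₁ * (o t).s3)) S t
  R₁ : HasDerivWithinAt (fun τ => (o τ).R₁) (ω * ((o t).c3 * (o t).s ^ 2 * (o t).s3)) S t
  R₂ : HasDerivWithinAt (fun τ => (o τ).R₂) (ω * ((o t).P₁ * (o t).s * (o t).s3)) S t
  R₃ : HasDerivWithinAt (fun τ => (o τ).R₃) (ω * ((o t).P₂ * (o t).s3)) S t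
  T₁ : HasDerivWithinAt (fun τ => (o τ).T₁) (ω * ((o t).c3 ^ 2 * (o t).s * (o t).s3)) S t
  T₂ : HasDerivWithinAt (fun τ => (o τ).T₂) (ω * ((o t).Q₁ * (o t).s3)) S t
  T₃ : HasDerivWithinAt (fun τ => (o τ).T₃) (ω * ((o t).Q₂ * (o t).s3)) S t

/-- Periodic primitives exist because the products have zero mean. The exception is `P₃`: sin³θ sin
3θ has mean -1/8, hence the added 1/8, the sole source of the averaged drift. -/
lemma oscOf_hasDeriv {ω t : ℝ} {S : Set ℝ} {s k : ℝ → ℝ} (hs : HasDerivWithinAt s (ω * k t) S t)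
    (hk : HasDerivWithinAt k (-(ω * s t)) S t) (h1 : k t ^ 2 = 1 - s t ^ 2) :
    Osc.HasDeriv (fun τ => oscOf (s τ) (k τ)) ω S t := by
  have e3 : k t ^ 3 = k t * (1 - s t ^ 2) := by rw [← h1]; ring
  have e4 : k t ^ 4 = (1 - s t ^ 2) ^ 2 := by rw [← h1]; ring
  have e5 : k t ^ 5 = k t * (1 - s t ^ 2) ^ 2 := by rw [← h1]; ring
  have e6 : k t ^ 6 = (1 - s t ^ 2) ^ 3 := by rw [← h1]; ring
  have e7 : k t ^ 7 = k t * (1 - s t ^ 2) ^ 3 := by rw [← h1]; ring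
  have p (n : ℕ) := hs.fun_pow n
  have q (n : ℕ) := hk.fun_pow n
  constructor
  · refine (hk.fun_mul (((p 2).const_mul 4).const_sub 1)).congr_deriv ?_
    simp only [oscOf]; ring_nf; simp only [h1]; ring
  · refine ((p 3).fun_mul hk).congr_deriv ?_
    simp only [oscOf]; push_cast; ring_nf; simp only [h1]; ring
  · refine ((hk.fun_sub ((q 3).const_mul (5 / 3))).fun_add ((q 5).const_mul (4 / 5))).congr_deriv ?_
    simp only [oscOf]; push_cast; ring_nf; simp only [h1, e4]; ring
  · refine (hk.fun_mul (((hs.div_const 8).fun_add ((p 3).div_const 12)).fun_add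
      ((p 5).const_mul (2 / 3)))).congr_deriv ?_
    simp only [oscOf]; push_cast; ring_nf; simp only [h1]; ring
  · refine (((p 3).fun_sub ((p 5).const_mul (16 / 5))).fun_add
      ((p 7).const_mul (16 / 7))).congr_deriv ?_
    simp only [oscOf]; push_cast; ring
  · refine (((p 5).const_mul (3 / 5)).fun_sub ((p 7).const_mul (4 / 7))).congr_deriv ?_
    simp only [oscOf]; push_cast; ring
  · refine ((((p 4).const_mul (3 / 4)).fun_sub ((p 6).const_mul (8 / 3))).fun_add
      ((p 8).const_mul 2)).congr_deriv ?_
    simp only [oscOf]; push_cast; ring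
  · refine (((p 6).div_const 2).fun_sub ((p 8).div_const 2)).congr_deriv ?_
    simp only [oscOf]; push_cast; ring
  · refine (((((q 2).div_const 2).fun_sub ((q 4).const_mul (17 / 12))).fun_add
      ((q 6).const_mul (112 / 90))).fun_sub ((q 8).const_mul (2 / 5))).congr_deriv ?_
    simp only [oscOf]; push_cast; ring_nf; simp only [e3, e5, e7]; ring
  · refine (hk.fun_mul ((((p 3).fun_sub ((p 5).const_mul (27 / 5))).fun_add
      ((p 7).const_mul (54 / 5))).fun_sub ((p 9).const_mul (32 / 5)))).congr_deriv ?_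
    simp only [oscOf]; push_cast; ring_nf; simp only [h1]; ring
  · refine (hk.fun_mul ((((p 5).const_mul (3 / 5)).fun_sub ((p 7).const_mul (10 / 7))).fun_add
      ((p 9).const_mul (32 / 35)))).congr_deriv ?_
    simp only [oscOf]; push_cast; ring_nf; simp only [h1]; ring
  · refine (hk.fun_mul (((p 7).const_mul (9 / 35)).fun_sub
      ((p 9).const_mul (8 / 35)))).congr_deriv ?_
    simp only [oscOf]; push_cast; ring_nf; simp only [h1]; ring

/-! ### Directional jets and the corrector -/

/-- Values of a function and of its first three directional derivatives. -/
structure Jet where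
  j₀ : ℝ
  j₁ : ℝ
  j₂ : ℝ
  j₃ : ℝ

namespace Jet

/-- Componentwise derivative of a curve of jets. -/
structure HasDeriv (j : ℝ → Jet) (v : Jet) (S : Set ℝ) (t : ℝ) : Prop where
  d₀ : HasDerivWithinAt (fun τ => (j τ).j₀) v.j₀ S t
  d₁ : HasDerivWithinAt (fun τ => (j τ).j₁) v.j₁ S t
  d₂ : HasDerivWithinAt (fun τ => (j τ).j₂) v.j₂ S t
  d₃ : HasDerivWithinAt (fun τ => (j τ).j₃) v.j₃ S t

end Jet

section Corrector

variable (α β : ℝ) (o : Osc) (j v : Jet)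

/-- Coefficient of `δ` in the near-identity transformation. -/
def corr₁ : ℝ := α / 3 * (o.c3 * j.j₀)

/-- Coefficient of `δ²` in the near-identity transformation. -/
def corr₂ : ℝ := -(α * β) * (o.P₁ * j.j₁) + α ^ 2 / 18 * (o.c3 ^ 2 * (j.j₀ * j.j₁))

/-- Coefficient of `δ³` in the near-identity transformation. -/
def corr₃ : ℝ :=
  -(α * β ^ 2 / 2) * (o.P₂ * j.j₂) - α ^ 2 * β / 3 * (o.Q₁ * j.j₁ ^ 2)
    + α ^ 2 * β * (o.Q₂ * (j.j₂ * j.j₀))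
    + α ^ 3 / 162 * (o.c3 ^ 3 * (j.j₂ * j.j₀ ^ 2 + j.j₁ ^ 2 * j.j₀))

/-- Coefficient of `δ⁴` in the near-identity transformation. -/
def corr₄ : ℝ :=
  -(α * β ^ 3 / 6) * (o.P₃ * j.j₃) - α ^ 2 * β ^ 2 / 6 * (o.R₁ * (j.j₁ * j.j₂))
    + α ^ 2 * β ^ 2 * (o.R₂ * (j.j₁ * j.j₂)) + α ^ 2 * β ^ 2 / 2 * (o.R₃ * (j.j₀ * j.j₃))
    - α ^ 3 * β / 18 * (o.T₁ * (j.j₁ ^ 3 + j.j₀ * (j.j₁ * j.j₂)))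
    + 2 / 3 * (α ^ 3 * β) * (o.T₂ * (j.j₀ * (j.j₁ * j.j₂)))
    - α ^ 3 * β * (o.T₃ * (j.j₃ * j.j₀ ^ 2 + j.j₀ * (j.j₁ * j.j₂)))
    + α ^ 4 / 1944 * (o.c3 ^ 4 * (j.j₃ * j.j₀ ^ 3 + 4 * (j.j₀ ^ 2 * (j.j₁ * j.j₂))
      + j.j₀ * j.j₁ ^ 3))

/-- Variation of `corr₁` when the jet moves with velocity `v`. -/
def dcorr₁ : ℝ := α / 3 * (o.c3 * v.j₀)

/-- Variation of `corr₂` when the jet moves with velocity `v`. -/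
def dcorr₂ : ℝ :=
  -(α * β) * (o.P₁ * v.j₁) + α ^ 2 / 18 * (o.c3 ^ 2 * (v.j₀ * j.j₁ + j.j₀ * v.j₁))

/-- Variation of `corr₃` when the jet moves with velocity `v`. -/
def dcorr₃ : ℝ :=
  -(α * β ^ 2 / 2) * (o.P₂ * v.j₂) - α ^ 2 * β / 3 * (o.Q₁ * (2 * j.j₁ * v.j₁))
    + α ^ 2 * β * (o.Q₂ * (v.j₂ * j.j₀ + j.j₂ * v.j₀))
    + α ^ 3 / 162 * (o.c3 ^ 3 * (v.j₂ * j.j₀ ^ 2 + j.j₂ * (2 * j.j₀ * v.j₀)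
      + (2 * j.j₁ * v.j₁ * j.j₀ + j.j₁ ^ 2 * v.j₀)))

/-- Variation of `corr₄` when the jet moves with velocity `v`. -/
def dcorr₄ : ℝ :=
  -(α * β ^ 3 / 6) * (o.P₃ * v.j₃)
    - α ^ 2 * β ^ 2 / 6 * (o.R₁ * (v.j₁ * j.j₂ + j.j₁ * v.j₂))
    + α ^ 2 * β ^ 2 * (o.R₂ * (v.j₁ * j.j₂ + j.j₁ * v.j₂))
    + α ^ 2 * β ^ 2 / 2 * (o.R₃ * (v.j₀ * j.j₃ + j.j₀ * v.j₃))
    - α ^ 3 * β / 18 * (o.T₁ * (3 * j.j₁ ^ 2 * v.j₁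
      + (v.j₀ * (j.j₁ * j.j₂) + j.j₀ * (v.j₁ * j.j₂ + j.j₁ * v.j₂))))
    + 2 / 3 * (α ^ 3 * β) * (o.T₂ *
      (v.j₀ * (j.j₁ * j.j₂) + j.j₀ * (v.j₁ * j.j₂ + j.j₁ * v.j₂)))
    - α ^ 3 * β * (o.T₃ * (v.j₃ * j.j₀ ^ 2 + j.j₃ * (2 * j.j₀ * v.j₀)
      + (v.j₀ * (j.j₁ * j.j₂) + j.j₀ * (v.j₁ * j.j₂ + j.j₁ * v.j₂))))
    + α ^ 4 / 1944 * (o.c3 ^ 4 * (v.j₃ * j.j₀ ^ 3 + j.j₃ * (3 * j.j₀ ^ 2 * v.j₀)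
      + 4 * (2 * j.j₀ * v.j₀ * (j.j₁ * j.j₂) + j.j₀ ^ 2 * (v.j₁ * j.j₂ + j.j₁ * v.j₂))
      + (v.j₀ * j.j₁ ^ 3 + j.j₀ * (3 * j.j₁ ^ 2 * v.j₁))))

end Corrector

section CorrectorDeriv

variable {α β ω t : ℝ} {S : Set ℝ} {o : ℝ → Osc} {j : ℝ → Jet} {v : Jet}

/-- In this and the next three derivatives, the part carrying ω cancels drift of one order in δ, and
the `dcorr` part, due to the motion of the jet, is passed on to higher orders. -/
lemma corr₁_hasDeriv (ho : Osc.HasDeriv o ω S t) (hj : Jet.HasDeriv j v S t) :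
    HasDerivWithinAt (fun τ => corr₁ α (o τ) (j τ))
      (-(ω * (α * ((o t).s3 * (j t).j₀))) + dcorr₁ α (o t) v) S t := by
  refine ((ho.c3.fun_mul hj.d₀).const_mul (α / 3)).congr_deriv ?_
  simp only [dcorr₁]; ring

lemma corr₂_hasDeriv (ho : Osc.HasDeriv o ω S t) (hj : Jet.HasDeriv j v S t) :
    HasDerivWithinAt (fun τ => corr₂ α β (o τ) (j τ))
      (-(ω * (α * β * ((o t).s * (o t).s3 * (j t).j₁)
        + α ^ 2 / 3 * ((o t).c3 * (o t).s3 * ((j t).j₀ * (j t).j₁))))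
        + dcorr₂ α β (o t) (j t) v) S t := by
  refine (((ho.P₁.fun_mul hj.d₁).const_mul (-(α * β))).fun_add
    (((ho.c3.fun_pow 2).fun_mul (hj.d₀.fun_mul hj.d₁)).const_mul (α ^ 2 / 18))).congr_deriv ?_
  simp only [dcorr₂]; push_cast; ring

lemma corr₃_hasDeriv (ho : Osc.HasDeriv o ω S t) (hj : Jet.HasDeriv j v S t) :
    HasDerivWithinAt (fun τ => corr₃ α β (o τ) (j τ))
      (-(ω * (α * β ^ 2 / 2 * ((o t).s ^ 2 * (o t).s3 * (j t).j₂)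
        + α ^ 2 * β / 3 * ((o t).c3 * (o t).s * (o t).s3 * (j t).j₁ ^ 2)
        - α ^ 2 * β * ((o t).P₁ * (o t).s3 * ((j t).j₂ * (j t).j₀))
        + α ^ 3 / 18 * ((o t).c3 ^ 2 * (o t).s3 *
          ((j t).j₂ * (j t).j₀ ^ 2 + (j t).j₁ ^ 2 * (j t).j₀))))
        + dcorr₃ α β (o t) (j t) v) S t := by
  refine (((((ho.P₂.fun_mul hj.d₂).const_mul (-(α * β ^ 2 / 2))).fun_sub
    ((ho.Q₁.fun_mul (hj.d₁.fun_pow 2)).const_mul (α ^ 2 * β / 3))).fun_add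
    ((ho.Q₂.fun_mul (hj.d₂.fun_mul hj.d₀)).const_mul (α ^ 2 * β))).fun_add
    (((ho.c3.fun_pow 3).fun_mul ((hj.d₂.fun_mul (hj.d₀.fun_pow 2)).fun_add
      ((hj.d₁.fun_pow 2).fun_mul hj.d₀))).const_mul (α ^ 3 / 162))).congr_deriv ?_
  simp only [dcorr₃]; push_cast; ring

lemma corr₄_hasDeriv (ho : Osc.HasDeriv o ω S t) (hj : Jet.HasDeriv j v S t) :
    HasDerivWithinAt (fun τ => corr₄ α β (o τ) (j τ))
      (-(ω * (α * β ^ 3 / 6 * (((o t).s ^ 3 * (o t).s3 + 1 / 8) * (j t).j₃)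
        + α ^ 2 * β ^ 2 / 6 * ((o t).c3 * (o t).s ^ 2 * (o t).s3 * ((j t).j₁ * (j t).j₂))
        - α ^ 2 * β ^ 2 * ((o t).P₁ * (o t).s * (o t).s3 * ((j t).j₁ * (j t).j₂))
        - α ^ 2 * β ^ 2 / 2 * ((o t).P₂ * (o t).s3 * ((j t).j₀ * (j t).j₃))
        + α ^ 3 * β / 18 * ((o t).c3 ^ 2 * (o t).s * (o t).s3 *
          ((j t).j₁ ^ 3 + (j t).j₀ * ((j t).j₁ * (j t).j₂)))
        - 2 / 3 * (α ^ 3 * β) * ((o t).Q₁ * (o t).s3 * ((j t).j₀ * ((j t).j₁ * (j t).j₂)))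
        + α ^ 3 * β * ((o t).Q₂ * (o t).s3 *
          ((j t).j₃ * (j t).j₀ ^ 2 + (j t).j₀ * ((j t).j₁ * (j t).j₂)))
        + α ^ 4 / 162 * ((o t).c3 ^ 3 * (o t).s3 * ((j t).j₃ * (j t).j₀ ^ 3
          + 4 * ((j t).j₀ ^ 2 * ((j t).j₁ * (j t).j₂)) + (j t).j₀ * (j t).j₁ ^ 3))))
        + dcorr₄ α β (o t) (j t) v) S t := by
  have h12 := hj.d₁.fun_mul hj.d₂
  have h012 := hj.d₀.fun_mul h12
  refine ((((((((ho.P₃.fun_mul hj.d₃).const_mul (-(α * β ^ 3 / 6))).fun_sub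
    ((ho.R₁.fun_mul h12).const_mul (α ^ 2 * β ^ 2 / 6))).fun_add
    ((ho.R₂.fun_mul h12).const_mul (α ^ 2 * β ^ 2))).fun_add
    ((ho.R₃.fun_mul (hj.d₀.fun_mul hj.d₃)).const_mul (α ^ 2 * β ^ 2 / 2))).fun_sub
    ((ho.T₁.fun_mul ((hj.d₁.fun_pow 3).fun_add h012)).const_mul (α ^ 3 * β / 18))).fun_add
    ((ho.T₂.fun_mul h012).const_mul (2 / 3 * (α ^ 3 * β)))).fun_sub
    ((ho.T₃.fun_mul ((hj.d₃.fun_mul (hj.d₀.fun_pow 2)).fun_add h012)).const_mul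
      (α ^ 3 * β))).fun_add
    (((ho.c3.fun_pow 4).fun_mul (((hj.d₃.fun_mul (hj.d₀.fun_pow 3)).fun_add
      (((hj.d₀.fun_pow 2).fun_mul h12).const_mul 4)).fun_add
      (hj.d₀.fun_mul (hj.d₁.fun_pow 3)))).const_mul (α ^ 4 / 1944)) |>.congr_deriv ?_
  simp only [dcorr₄]; push_cast; ring

end CorrectorDeriv

/-- The near-identity displacement along the direction of motion. -/
def corrector (α β δ : ℝ) (o : Osc) (j : Jet) : ℝ :=
  corr₁ α o j + δ * corr₂ α β o j + δ ^ 2 * corr₃ α β o j + δ ^ 3 * corr₄ α β o j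

/-- The Taylor polynomial of the objective along the dither. -/
def taylorSum (β δ : ℝ) (o : Osc) (j : Jet) (j₄ : ℝ) : ℝ :=
  j.j₀ + δ * β * o.s * j.j₁ + (δ * β * o.s) ^ 2 * j.j₂ / 2 + (δ * β * o.s) ^ 3 * j.j₃ / 6
    + (δ * β * o.s) ^ 4 * j₄ / 24

/-- The part of the drift of the transformed variable of relative order `δ`. -/
def remainder (α β δ : ℝ) (o : Osc) (j : Jet) (j₄ : ℝ) (r : Jet) : ℝ :=
  let d : Jet := ⟨j.j₁, j.j₂, j.j₃, j₄⟩
  let g₀ := α * o.s3 * j.j₀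
  let g₁ := α * o.s3 * (β * o.s * j.j₁)
  let g₂ := α * o.s3 * ((β * o.s) ^ 2 * j.j₂ / 2)
  let g₃ := α * o.s3 * ((β * o.s) ^ 3 * j.j₃ / 6)
  let g₄ := α * o.s3 * ((β * o.s) ^ 4 * j₄ / 24)
  g₄ + dcorr₁ α o d * (g₃ + δ * g₄) + dcorr₂ α β o j d * (g₂ + δ * g₃ + δ ^ 2 * g₄)
    + dcorr₃ α β o j d * (g₁ + δ * g₂ + δ ^ 2 * g₃ + δ ^ 3 * g₄)
    + dcorr₄ α β o j d * (g₀ + δ * g₁ + δ ^ 2 * g₂ + δ ^ 3 * g₃ + δ ^ 4 * g₄)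
    + dcorr₁ α o r + δ * dcorr₂ α β o j r + δ ^ 2 * dcorr₃ α β o j r + δ ^ 3 * dcorr₄ α β o j r

/-- The corrector cancels the oscillating drift up to its average and a small remainder. -/
lemma corrector_hasDeriv {α β δ t ζ j₄ : ℝ} {S : Set ℝ} {o : ℝ → Osc} {j : ℝ → Jet} {r : Jet}
    (hδ : δ ≠ 0) (ho : Osc.HasDeriv o (δ⁻¹ ^ 4) S t)
    (hζ : ζ = δ⁻¹ ^ 3 * (α * (o t).s3 * taylorSum β δ (o t) (j t) j₄))
    (hj : Jet.HasDeriv j ⟨(j t).j₁ * ζ + r.j₀, (j t).j₂ * ζ + r.j₁, (j t).j₃ * ζ + r.j₂,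
      j₄ * ζ + r.j₃⟩ S t) :
    HasDerivWithinAt (fun τ => δ * corrector α β δ (o τ) (j τ))
      (-ζ - α * β ^ 3 / 48 * (j t).j₃ + δ * remainder α β δ (o t) (j t) j₄ r) S t := by
  have h := (((((corr₁_hasDeriv (α := α) ho hj).fun_add
    ((corr₂_hasDeriv (α := α) (β := β) ho hj).const_mul δ)).fun_add
    ((corr₃_hasDeriv (α := α) (β := β) ho hj).const_mul (δ ^ 2))).fun_add
    ((corr₄_hasDeriv (α := α) (β := β) ho hj).const_mul (δ ^ 3))).const_mul δ)
  refine h.congr_deriv ?_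
  generalize o t = o at *
  generalize j t = j at *
  have lin1 : dcorr₁ α o ⟨j.j₁ * ζ + r.j₀, j.j₂ * ζ + r.j₁, j.j₃ * ζ + r.j₂, j₄ * ζ + r.j₃⟩
      = dcorr₁ α o ⟨j.j₁, j.j₂, j.j₃, j₄⟩ * ζ + dcorr₁ α o r := by
    simp only [dcorr₁]; ring
  have lin2 : dcorr₂ α β o j ⟨j.j₁ * ζ + r.j₀, j.j₂ * ζ + r.j₁, j.j₃ * ζ + r.j₂, j₄ * ζ + r.j₃⟩
      = dcorr₂ α β o j ⟨j.j₁, j.j₂, j.j₃, j₄⟩ * ζ + dcorr₂ α β o j r := by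
    simp only [dcorr₂]; ring
  have lin3 : dcorr₃ α β o j ⟨j.j₁ * ζ + r.j₀, j.j₂ * ζ + r.j₁, j.j₃ * ζ + r.j₂, j₄ * ζ + r.j₃⟩
      = dcorr₃ α β o j ⟨j.j₁, j.j₂, j.j₃, j₄⟩ * ζ + dcorr₃ α β o j r := by
    simp only [dcorr₃]; ring
  have lin4 : dcorr₄ α β o j ⟨j.j₁ * ζ + r.j₀, j.j₂ * ζ + r.j₁, j.j₃ * ζ + r.j₂, j₄ * ζ + r.j₃⟩
      = dcorr₄ α β o j ⟨j.j₁, j.j₂, j.j₃, j₄⟩ * ζ + dcorr₄ α β o j r := by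
    simp only [dcorr₄]; ring
  rw [lin1, lin2, lin3, lin4, hζ]
  -- `E2`, `E3`, `E4` match the drift created by the earlier correctors at each order with what the
  -- fast part of the next one cancels.
  have E2 : dcorr₁ α o ⟨j.j₁, j.j₂, j.j₃, j₄⟩ * (α * o.s3 * j.j₀)
      = α ^ 2 / 3 * (o.c3 * o.s3 * (j.j₀ * j.j₁)) := by
    simp only [dcorr₁]; ring
  have E3 : dcorr₁ α o ⟨j.j₁, j.j₂, j.j₃, j₄⟩ * (α * o.s3 * (β * o.s * j.j₁))
      + dcorr₂ α β o j ⟨j.j₁, j.j₂, j.j₃, j₄⟩ * (α * o.s3 * j.j₀)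
      = α ^ 2 * β / 3 * (o.c3 * o.s * o.s3 * j.j₁ ^ 2)
        - α ^ 2 * β * (o.P₁ * o.s3 * (j.j₂ * j.j₀))
        + α ^ 3 / 18 * (o.c3 ^ 2 * o.s3 * (j.j₂ * j.j₀ ^ 2 + j.j₁ ^ 2 * j.j₀)) := by
    simp only [dcorr₁, dcorr₂]; ring
  have E4 : dcorr₁ α o ⟨j.j₁, j.j₂, j.j₃, j₄⟩ * (α * o.s3 * ((β * o.s) ^ 2 * j.j₂ / 2))
      + dcorr₂ α β o j ⟨j.j₁, j.j₂, j.j₃, j₄⟩ * (α * o.s3 * (β * o.s * j.j₁))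
      + dcorr₃ α β o j ⟨j.j₁, j.j₂, j.j₃, j₄⟩ * (α * o.s3 * j.j₀)
      = α ^ 2 * β ^ 2 / 6 * (o.c3 * o.s ^ 2 * o.s3 * (j.j₁ * j.j₂))
        - α ^ 2 * β ^ 2 * (o.P₁ * o.s * o.s3 * (j.j₁ * j.j₂))
        - α ^ 2 * β ^ 2 / 2 * (o.P₂ * o.s3 * (j.j₀ * j.j₃))
        + α ^ 3 * β / 18 * (o.c3 ^ 2 * o.s * o.s3 * (j.j₁ ^ 3 + j.j₀ * (j.j₁ * j.j₂)))
        - 2 / 3 * (α ^ 3 * β) * (o.Q₁ * o.s3 * (j.j₀ * (j.j₁ * j.j₂)))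
        + α ^ 3 * β * (o.Q₂ * o.s3 * (j.j₃ * j.j₀ ^ 2 + j.j₀ * (j.j₁ * j.j₂)))
        + α ^ 4 / 162 * (o.c3 ^ 3 * o.s3 * (j.j₃ * j.j₀ ^ 3
          + 4 * (j.j₀ ^ 2 * (j.j₁ * j.j₂)) + j.j₀ * j.j₁ ^ 3)) := by
    simp only [dcorr₁, dcorr₂, dcorr₃]; ring
  simp only [remainder, taylorSum]
  generalize dcorr₁ α o ⟨j.j₁, j.j₂, j.j₃, j₄⟩ = L₁ at *
  generalize dcorr₂ α β o j ⟨j.j₁, j.j₂, j.j₃, j₄⟩ = L₂ at *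
  generalize dcorr₃ α β o j ⟨j.j₁, j.j₂, j.j₃, j₄⟩ = L₃ at *
  generalize dcorr₄ α β o j ⟨j.j₁, j.j₂, j.j₃, j₄⟩ = L₄ at *
  rw [← E2, ← sub_eq_zero]
  field_simp
  -- The integer is the numerical denominator cleared by `field_simp`, along with δ³.
  linear_combination 967458816 * (δ ^ 2 * E3 + δ ^ 3 * E4)

/-! ### The quartic objective and the near-identity transformation -/

/-- Value and directional derivatives along `(c, σ)` of `C₁ x⁴ + C₂ y⁴`. -/
def quarticJet (C₁ C₂ x y c σ : ℝ) : Jet where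
  j₀ := C₁ * x ^ 4 + C₂ * y ^ 4
  j₁ := 4 * (C₁ * x ^ 3 * c + C₂ * y ^ 3 * σ)
  j₂ := 12 * (C₁ * x ^ 2 * c ^ 2 + C₂ * y ^ 2 * σ ^ 2)
  j₃ := 24 * (C₁ * c ^ 3 * x + C₂ * σ ^ 3 * y)

/-- The constant fourth directional derivative along `(c, σ)` of `C₁ x⁴ + C₂ y⁴`. -/
def quarticTop (C₁ C₂ c σ : ℝ) : ℝ := 24 * (C₁ * c ^ 4 + C₂ * σ ^ 4)

/-- The part of the derivative of `quarticJet` due to a transversal velocity `(n₁, n₂)` and to the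
rotation of the direction `(c, σ)` at rate `Ω`. -/
def quarticSlow (C₁ C₂ Ω x y c σ n₁ n₂ : ℝ) : Jet where
  j₀ := 4 * (C₁ * x ^ 3 * n₁ + C₂ * y ^ 3 * n₂)
  j₁ := 4 * (C₁ * (3 * x ^ 2 * n₁ * c - x ^ 3 * (Ω * σ))
    + C₂ * (3 * y ^ 2 * n₂ * σ + y ^ 3 * (Ω * c)))
  j₂ := 12 * (C₁ * (2 * x * n₁ * c ^ 2 - x ^ 2 * (2 * c * (Ω * σ)))
    + C₂ * (2 * y * n₂ * σ ^ 2 + y ^ 2 * (2 * σ * (Ω * c))))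
  j₃ := 24 * (C₁ * (n₁ * c ^ 3 - x * (3 * c ^ 2 * (Ω * σ)))
    + C₂ * (n₂ * σ ^ 3 + y * (3 * σ ^ 2 * (Ω * c))))

/-- Moving along (c, σ) shifts each derivative to the next one; `quarticSlow` collects the rest,
which carries no factor ζ of size δ⁻³. -/
lemma quarticJet_hasDeriv {C₁ C₂ Ω ζ n₁ n₂ t : ℝ} {S : Set ℝ} {x y c σ : ℝ → ℝ}
    (hx : HasDerivWithinAt x (ζ * c t + n₁) S t) (hy : HasDerivWithinAt y (ζ * σ t + n₂) S t)
    (hc : HasDerivWithinAt c (-(Ω * σ t)) S t) (hσ : HasDerivWithinAt σ (Ω * c t) S t) :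
    Jet.HasDeriv (fun τ => quarticJet C₁ C₂ (x τ) (y τ) (c τ) (σ τ))
      ⟨(quarticJet C₁ C₂ (x t) (y t) (c t) (σ t)).j₁ * ζ
          + (quarticSlow C₁ C₂ Ω (x t) (y t) (c t) (σ t) n₁ n₂).j₀,
        (quarticJet C₁ C₂ (x t) (y t) (c t) (σ t)).j₂ * ζ
          + (quarticSlow C₁ C₂ Ω (x t) (y t) (c t) (σ t) n₁ n₂).j₁,
        (quarticJet C₁ C₂ (x t) (y t) (c t) (σ t)).j₃ * ζ
          + (quarticSlow C₁ C₂ Ω (x t) (y t) (c t) (σ t) n₁ n₂).j₂,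
        quarticTop C₁ C₂ (c t) (σ t) * ζ
          + (quarticSlow C₁ C₂ Ω (x t) (y t) (c t) (σ t) n₁ n₂).j₃⟩ S t := by
  constructor
  · refine (((hx.fun_pow 4).const_mul C₁).fun_add ((hy.fun_pow 4).const_mul C₂)).congr_deriv ?_
    simp only [quarticJet, quarticSlow]; push_cast; ring
  · refine (((((hx.fun_pow 3).const_mul C₁).fun_mul hc).fun_add
      (((hy.fun_pow 3).const_mul C₂).fun_mul hσ)).const_mul 4).congr_deriv ?_
    simp only [quarticJet, quarticSlow]; push_cast; ring
  · refine (((((hx.fun_pow 2).const_mul C₁).fun_mul (hc.fun_pow 2)).fun_add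
      (((hy.fun_pow 2).const_mul C₂).fun_mul (hσ.fun_pow 2))).const_mul 12).congr_deriv ?_
    simp only [quarticJet, quarticSlow]; push_cast; ring
  · refine (((((hc.fun_pow 3).const_mul C₁).fun_mul hx).fun_add
      (((hσ.fun_pow 3).const_mul C₂).fun_mul hy)).const_mul 24).congr_deriv ?_
    simp only [quarticTop, quarticSlow]; push_cast; ring

lemma taylorSum_quarticJet (C₁ C₂ x y c σ β δ s k : ℝ) :
    taylorSum β δ (oscOf s k) (quarticJet C₁ C₂ x y c σ) (quarticTop C₁ C₂ c σ)
      = C₁ * (x + δ * β * s * c) ^ 4 + C₂ * (y + δ * β * s * σ) ^ 4 := by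
  simp only [taylorSum, oscOf, quarticJet, quarticTop]; ring

lemma exists_bound_on_box {n : ℕ} (f : (Fin n → ℝ) → ℝ) (hf : Continuous f) (B : ℝ) :
    ∃ K, ∀ p : Fin n → ℝ, (∀ i, |p i| ≤ B) → |f p| ≤ K := by
  obtain ⟨K, hK⟩ := (isCompact_Icc (a := fun _ : Fin n => -B) (b := fun _ => B))
    |>.exists_bound_of_continuousOn hf.continuousOn
  exact ⟨K, fun p hp => hK p ⟨fun i => (abs_le.1 (hp i)).1, fun i => (abs_le.1 (hp i)).2⟩⟩

/-- The corrector in terms of `(δ, x, y, c, σ, s, k)`. -/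
def correctorAt (α β C₁ C₂ δ x y c σ s k : ℝ) : ℝ :=
  corrector α β δ (oscOf s k) (quarticJet C₁ C₂ x y c σ)

/-- The remainder in terms of `(δ, x, y, c, σ, s, k)`. -/
def remainderAt (α β C₁ C₂ Ω δ x y c σ s k : ℝ) : ℝ :=
  remainder α β δ (oscOf s k) (quarticJet C₁ C₂ x y c σ) (quarticTop C₁ C₂ c σ)
    (quarticSlow C₁ C₂ Ω x y c σ (δ * β * Ω * s * σ) (-(δ * β * Ω * s * c)))

lemma continuous_correctorAt (α β C₁ C₂ : ℝ) : Continuous fun p : Fin 7 → ℝ =>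
    correctorAt α β C₁ C₂ (p 0) (p 1) (p 2) (p 3) (p 4) (p 5) (p 6) := by
  simp only [correctorAt, corrector, corr₁, corr₂, corr₃, corr₄, oscOf, quarticJet]
  fun_prop

lemma continuous_remainderAt (α β C₁ C₂ Ω : ℝ) : Continuous fun p : Fin 7 → ℝ =>
    remainderAt α β C₁ C₂ Ω (p 0) (p 1) (p 2) (p 3) (p 4) (p 5) (p 6) := by
  simp only [remainderAt, remainder, dcorr₁, dcorr₂, dcorr₃, dcorr₄, oscOf, quarticJet,
    quarticTop, quarticSlow]
  fun_prop

/-- Both functions are polynomial in all seven variables, δ included, so compactness of a box gives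
bounds uniform in time and in δ. -/
lemma exists_uniform_bounds (α β C₁ C₂ Ω B : ℝ) : ∃ K > 0, ∀ δ x y c σ s k : ℝ,
    |δ| ≤ B → |x| ≤ B → |y| ≤ B → |c| ≤ B → |σ| ≤ B → |s| ≤ B → |k| ≤ B →
    |correctorAt α β C₁ C₂ δ x y c σ s k| ≤ K ∧ |remainderAt α β C₁ C₂ Ω δ x y c σ s k| ≤ K := by
  obtain ⟨K₁, h₁⟩ := exists_bound_on_box _ (continuous_correctorAt α β C₁ C₂) B
  obtain ⟨K₂, h₂⟩ := exists_bound_on_box _ (continuous_remainderAt α β C₁ C₂ Ω) B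
  refine ⟨max 1 (max K₁ K₂), by positivity, fun δ x y c σ s k a1 a2 a3 a4 a5 a6 a7 => ?_⟩
  have hp : ∀ i, |(![δ, x, y, c, σ, s, k] : Fin 7 → ℝ) i| ≤ B := by
    intro i
    fin_cases i <;> assumption
  exact ⟨(h₁ _ hp).trans ((le_max_left _ _).trans (le_max_right _ _)),
    (h₂ _ hp).trans ((le_max_right _ _).trans (le_max_right _ _))⟩

lemma abs_mul_le_of_abs_le_one {a b K : ℝ} (ha : |a| ≤ K) (hb : |b| ≤ 1) : |a * b| ≤ K := by
  rw [abs_mul]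
  exact (mul_le_of_le_one_right (abs_nonneg _) hb).trans ha

/-- Near-identity transformation to the averaged system, uniformly on bounded sets. -/
theorem exists_near_identity (α β C₁ C₂ Ω R : ℝ) :
    ∃ K > 0, ∀ δ ∈ Set.Ioc (0 : ℝ) 1, ∀ (x y : ℝ → ℝ) (S : Set ℝ),
      (∀ t ∈ S, |x t| ≤ R ∧ |y t| ≤ R ∧
        HasDerivWithinAt x (δ⁻¹ ^ 3 * (α * (3 * Real.sin (δ⁻¹ ^ 4 * t)
          - 4 * Real.sin (δ⁻¹ ^ 4 * t) ^ 3) * (C₁ * x t ^ 4 + C₂ * y t ^ 4)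
          + β * Real.cos (δ⁻¹ ^ 4 * t)) * Real.cos (Ω * t)) S t ∧
        HasDerivWithinAt y (δ⁻¹ ^ 3 * (α * (3 * Real.sin (δ⁻¹ ^ 4 * t)
          - 4 * Real.sin (δ⁻¹ ^ 4 * t) ^ 3) * (C₁ * x t ^ 4 + C₂ * y t ^ 4)
          + β * Real.cos (δ⁻¹ ^ 4 * t)) * Real.sin (Ω * t)) S t) →
      ∃ u w : ℝ → ℝ, ∀ t ∈ S, |u t - x t| ≤ K * δ ∧ |w t - y t| ≤ K * δ ∧
        ∃ e₁ e₂ : ℝ, |e₁| ≤ K * δ ∧ |e₂| ≤ K * δ ∧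
          HasDerivWithinAt u (-(α * β ^ 3 / 2 * rotatingForm C₁ C₂ Ω t (u t) (w t)
            * Real.cos (Ω * t)) + e₁) S t ∧
          HasDerivWithinAt w (-(α * β ^ 3 / 2 * rotatingForm C₁ C₂ Ω t (u t) (w t)
            * Real.sin (Ω * t)) + e₂) S t := by
  obtain ⟨K, hK, hbd⟩ := exists_uniform_bounds α β C₁ C₂ Ω (|R| + |β| + 1)
  set L := |α * β ^ 3 / 2| * (|C₁| + |C₂|) with hL
  refine ⟨K + |β * Ω| + K * |Ω| + L * K + |β|, by positivity, fun δ hδ x y S hS => ?_⟩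
  have hδ0 : δ ≠ 0 := hδ.1.ne'
  let c : ℝ → ℝ := fun t => Real.cos (Ω * t)
  let σ : ℝ → ℝ := fun t => Real.sin (Ω * t)
  let s : ℝ → ℝ := fun t => Real.sin (δ⁻¹ ^ 4 * t)
  let k : ℝ → ℝ := fun t => Real.cos (δ⁻¹ ^ 4 * t)
  let z₁ : ℝ → ℝ := fun t => x t - δ * β * s t * c t
  let z₂ : ℝ → ℝ := fun t => y t - δ * β * s t * σ t
  let U : ℝ → ℝ := fun t => correctorAt α β C₁ C₂ δ (z₁ t) (z₂ t) (c t) (σ t) (s t) (k t)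
  refine ⟨fun t => z₁ t + δ * U t * c t, fun t => z₂ t + δ * U t * σ t, fun t ht => ?_⟩
  obtain ⟨hxR, hyR, hx, hy⟩ := hS t ht
  have hc1 : |c t| ≤ 1 := Real.abs_cos_le_one _
  have hσ1 : |σ t| ≤ 1 := Real.abs_sin_le_one _
  have hs1 : |s t| ≤ 1 := Real.abs_sin_le_one _
  have hk1 : |k t| ≤ 1 := Real.abs_cos_le_one _
  have hδ1 : |δ| ≤ 1 := by rw [abs_of_pos hδ.1]; exact hδ.2
  have hc : HasDerivWithinAt c (-(Ω * σ t)) S t := (hasDerivAt_cos_mul Ω t).hasDerivWithinAt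
  have hσ : HasDerivWithinAt σ (Ω * c t) S t := (hasDerivAt_sin_mul Ω t).hasDerivWithinAt
  have hs : HasDerivWithinAt s (δ⁻¹ ^ 4 * k t) S t := (hasDerivAt_sin_mul _ t).hasDerivWithinAt
  have hk : HasDerivWithinAt k (-(δ⁻¹ ^ 4 * s t)) S t := (hasDerivAt_cos_mul _ t).hasDerivWithinAt
  have hks : k t ^ 2 = 1 - s t ^ 2 := Real.cos_sq' _
  have ho := oscOf_hasDeriv hs hk hks
  set ζ := δ⁻¹ ^ 3 * (α * (3 * s t - 4 * s t ^ 3) * (C₁ * x t ^ 4 + C₂ * y t ^ 4)) with hζ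
  -- The derivative of sin θ cancels the β-term; the rotation of the heading leaves a term of size
  -- δ.
  have hz₁ : HasDerivWithinAt z₁ (ζ * c t + δ * β * Ω * s t * σ t) S t := by
    refine (hx.fun_sub ((hs.const_mul (δ * β)).fun_mul hc)).congr_deriv ?_
    simp only [hζ]
    change δ⁻¹ ^ 3 * (α * (3 * s t - 4 * s t ^ 3) * (C₁ * x t ^ 4 + C₂ * y t ^ 4) + β * k t) * c t
      - (δ * β * (δ⁻¹ ^ 4 * k t) * c t + δ * β * s t * -(Ω * σ t)) = _
    field_simp
    ring
  have hz₂ : HasDerivWithinAt z₂ (ζ * σ t + -(δ * β * Ω * s t * c t)) S t := by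
    refine (hy.fun_sub ((hs.const_mul (δ * β)).fun_mul hσ)).congr_deriv ?_
    simp only [hζ]
    change δ⁻¹ ^ 3 * (α * (3 * s t - 4 * s t ^ 3) * (C₁ * x t ^ 4 + C₂ * y t ^ 4) + β * k t) * σ t
      - (δ * β * (δ⁻¹ ^ 4 * k t) * σ t + δ * β * s t * (Ω * c t)) = _
    field_simp
    ring
  have hj := quarticJet_hasDeriv (C₁ := C₁) (C₂ := C₂) hz₁ hz₂ hc hσ
  have hζ' : ζ = δ⁻¹ ^ 3 * (α * (oscOf (s t) (k t)).s3 * taylorSum β δ (oscOf (s t) (k t))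
      (quarticJet C₁ C₂ (z₁ t) (z₂ t) (c t) (σ t)) (quarticTop C₁ C₂ (c t) (σ t))) := by
    rw [taylorSum_quarticJet]
    simp only [hζ, oscOf, z₁, z₂]
    ring
  have hU : HasDerivWithinAt (fun τ => δ * U τ) _ S t :=
    corrector_hasDeriv (β := β) hδ0 ho hζ' hj
  obtain ⟨bU, bR⟩ := hbd δ (z₁ t) (z₂ t) (c t) (σ t) (s t) (k t)
    (by linarith [abs_nonneg R, abs_nonneg β])
    (by
      have : |δ * β * s t * c t| ≤ |β| := by
        refine abs_mul_le_of_abs_le_one (abs_mul_le_of_abs_le_one ?_ hs1) hc1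
        rw [mul_comm]; exact abs_mul_le_of_abs_le_one le_rfl hδ1
      calc |z₁ t| ≤ |x t| + |δ * β * s t * c t| := abs_sub _ _
        _ ≤ _ := by linarith [le_abs_self R])
    (by
      have : |δ * β * s t * σ t| ≤ |β| := by
        refine abs_mul_le_of_abs_le_one (abs_mul_le_of_abs_le_one ?_ hs1) hσ1
        rw [mul_comm]; exact abs_mul_le_of_abs_le_one le_rfl hδ1
      calc |z₂ t| ≤ |y t| + |δ * β * s t * σ t| := abs_sub _ _
        _ ≤ _ := by linarith [le_abs_self R])
    (by linarith [abs_nonneg R, abs_nonneg β]) (by linarith [abs_nonneg R, abs_nonneg β])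
    (by linarith [abs_nonneg R, abs_nonneg β]) (by linarith [abs_nonneg R, abs_nonneg β])
  set ρ := remainderAt α β C₁ C₂ Ω δ (z₁ t) (z₂ t) (c t) (σ t) (s t) (k t) with hρ
  change |U t| ≤ K at bU
  have hp : |α * β ^ 3 / 2 * (C₁ * c t ^ 4 + C₂ * σ t ^ 4)| ≤ L := by
    rw [abs_mul]
    have q1 : |C₁ * c t ^ 4| ≤ |C₁| :=
      abs_mul_le_of_abs_le_one le_rfl (by rw [abs_pow]; exact pow_le_one₀ (abs_nonneg _) hc1)
    have q2 : |C₂ * σ t ^ 4| ≤ |C₂| :=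
      abs_mul_le_of_abs_le_one le_rfl (by rw [abs_pow]; exact pow_le_one₀ (abs_nonneg _) hσ1)
    rw [hL]
    gcongr
    exact (abs_add_le _ _).trans (add_le_add q1 q2)
  have hpU : |α * β ^ 3 / 2 * (C₁ * c t ^ 4 + C₂ * σ t ^ 4) * U t| ≤ L * K := by
    rw [abs_mul]; gcongr
  have bβ : |β * s t| ≤ |β| := abs_mul_le_of_abs_le_one le_rfl hs1
  have bβΩ : |β * Ω * s t| ≤ |β * Ω| := abs_mul_le_of_abs_le_one le_rfl hs1
  have bUΩ : |U t * Ω| ≤ K * |Ω| := by rw [abs_mul]; gcongr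
  have total (a b : ℝ) (hab : |a| ≤ b) : |δ * a| ≤ b * δ := by
    rw [abs_mul, abs_of_pos hδ.1, mul_comm]
    exact mul_le_mul_of_nonneg_right hab hδ.1.le
  have hLK : 0 ≤ L * K := by positivity
  have hKΩ : 0 ≤ K * |Ω| := by positivity
  have hβΩ := abs_nonneg (β * Ω)
  have hβ := abs_nonneg β
  -- The errors are, in order: the remainder, the heading's rotation in the dither, its rotation in
  -- the corrector, and the change of the rotating form from (z₁, z₂) to the transformed point.
  refine ⟨?_, ?_, δ * (ρ * c t + β * Ω * s t * σ t - U t * Ω * σ t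
    + α * β ^ 3 / 2 * (C₁ * c t ^ 4 + C₂ * σ t ^ 4) * U t * c t),
    δ * (ρ * σ t - β * Ω * s t * c t + U t * Ω * c t
    + α * β ^ 3 / 2 * (C₁ * c t ^ 4 + C₂ * σ t ^ 4) * U t * σ t), ?_, ?_, ?_, ?_⟩
  · have e : z₁ t + δ * U t * c t - x t = δ * (U t * c t - β * s t * c t) := by
      simp only [z₁]; ring
    rw [e]
    refine total _ _ ((abs_sub _ _).trans ?_)
    linarith [abs_mul_le_of_abs_le_one bU hc1, abs_mul_le_of_abs_le_one bβ hc1]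
  · have e : z₂ t + δ * U t * σ t - y t = δ * (U t * σ t - β * s t * σ t) := by
      simp only [z₂]; ring
    rw [e]
    refine total _ _ ((abs_sub _ _).trans ?_)
    linarith [abs_mul_le_of_abs_le_one bU hσ1, abs_mul_le_of_abs_le_one bβ hσ1]
  · refine total _ _ ((abs_add_le _ _).trans ?_)
    have := abs_sub (ρ * c t + β * Ω * s t * σ t) (U t * Ω * σ t)
    have := abs_add_le (ρ * c t) (β * Ω * s t * σ t)
    linarith [abs_mul_le_of_abs_le_one bR hc1, abs_mul_le_of_abs_le_one bβΩ hσ1,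
      abs_mul_le_of_abs_le_one bUΩ hσ1, abs_mul_le_of_abs_le_one hpU hc1]
  · refine total _ _ ((abs_add_le _ _).trans ?_)
    have := abs_add_le (ρ * σ t - β * Ω * s t * c t) (U t * Ω * c t)
    have := abs_sub (ρ * σ t) (β * Ω * s t * c t)
    linarith [abs_mul_le_of_abs_le_one bR hσ1, abs_mul_le_of_abs_le_one bβΩ hc1,
      abs_mul_le_of_abs_le_one bUΩ hc1, abs_mul_le_of_abs_le_one hpU hσ1]
  · refine (hz₁.fun_add (hU.fun_mul hc)).congr_deriv ?_
    change ζ * c t + δ * β * Ω * s t * σ t + ((-ζ - α * β ^ 3 / 48 *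
      (24 * (C₁ * c t ^ 3 * z₁ t + C₂ * σ t ^ 3 * z₂ t)) + δ * ρ) * c t
      + δ * U t * -(Ω * σ t)) = -(α * β ^ 3 / 2 * (C₁ * c t ^ 3 * (z₁ t + δ * U t * c t)
        + C₂ * σ t ^ 3 * (z₂ t + δ * U t * σ t)) * c t) + _
    ring
  · refine (hz₂.fun_add (hU.fun_mul hσ)).congr_deriv ?_
    change ζ * σ t + -(δ * β * Ω * s t * c t) + ((-ζ - α * β ^ 3 / 48 *
      (24 * (C₁ * c t ^ 3 * z₁ t + C₂ * σ t ^ 3 * z₂ t)) + δ * ρ) * σ t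
      + δ * U t * (Ω * c t)) = -(α * β ^ 3 / 2 * (C₁ * c t ^ 3 * (z₁ t + δ * U t * c t)
        + C₂ * σ t ^ 3 * (z₂ t + δ * U t * σ t)) * σ t) + _
    ring

/-! ### Decay, confinement and existence -/

lemma le_exp_decay_of_deriv_le {f : ℝ → ℝ} {T q m : ℝ} (hq : 0 < q) (hm : 0 ≤ m)
    (hf : ∀ t ∈ Set.Icc 0 T, ∃ D, HasDerivWithinAt f D (Set.Icc 0 T) t ∧ D ≤ -q * f t + m)
    {t : ℝ} (ht : t ∈ Set.Icc 0 T) : f t ≤ f 0 * Real.exp (-(q * t)) + m / q := by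
  have hq' : q * (m / q) = m := by field_simp
  choose! D hD hDle using hf
  have hd : ∀ τ ∈ Set.Icc 0 T, HasDerivWithinAt (fun τ => Real.exp (q * τ) * (f τ - m / q))
      (Real.exp (q * τ) * (q * f τ - m + D τ)) (Set.Icc 0 T) τ := by
    intro τ hτ
    have h1 := ((hasDerivAt_id τ).const_mul q).exp.hasDerivWithinAt (s := Set.Icc 0 T)
    refine (h1.fun_mul ((hD τ hτ).sub_const (m / q))).congr_deriv ?_
    simp only [id]
    rw [← hq']
    field_simp
  have hanti : AntitoneOn (fun τ => Real.exp (q * τ) * (f τ - m / q)) (Set.Icc 0 T) := by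
    refine antitoneOn_of_hasDerivWithinAt_nonpos (convex_Icc 0 T)
      (fun τ hτ => (hd τ hτ).continuousWithinAt)
      (fun τ hτ => (hd τ (interior_subset hτ)).mono interior_subset) fun τ hτ => ?_
    have := hDle τ (interior_subset hτ)
    exact mul_nonpos_of_nonneg_of_nonpos (Real.exp_pos _).le (by linarith)
  have h0 := hanti ⟨le_rfl, ht.1.trans ht.2⟩ ht ht.1
  simp only [mul_zero, Real.exp_zero, one_mul] at h0
  have h2 : f t - m / q ≤ (f 0 - m / q) * Real.exp (-(q * t)) := by
    rw [Real.exp_neg, ← div_eq_mul_inv, le_div_iff₀ (Real.exp_pos _), mul_comm]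
    exact h0
  have h3 : 0 ≤ m / q * Real.exp (-(q * t)) := by positivity
  linarith

/-- At the earliest time with N = R, the intermediate value theorem gives N ≤ R beforehand, so
`hstep` contradicts equality. -/
lemma confined_of_first_exit {N : ℝ → ℝ} {T R : ℝ} (hN : ContinuousOn N (Set.Icc 0 T))
    (h0 : N 0 < R)
    (hstep : ∀ t₁ ∈ Set.Icc 0 T, (∀ t ∈ Set.Icc 0 t₁, N t ≤ R) → N t₁ < R) :
    ∀ t ∈ Set.Icc 0 T, N t < R := by
  by_contra! hcon
  obtain ⟨t, ht, hRt⟩ := hcon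
  have hsub (a : ℝ) (ha : a ∈ Set.Icc 0 T) (hRa : R ≤ N a) : ∃ b ∈ Set.Icc 0 a, N b = R :=
    intermediate_value_Icc ha.1 (hN.mono (Set.Icc_subset_Icc_right ha.2)) ⟨h0.le, hRa⟩
  have hclosed : IsClosed (Set.Icc 0 T ∩ N ⁻¹' {R}) :=
    hN.preimage_isClosed_of_isClosed isClosed_Icc isClosed_singleton
  have hcomp : IsCompact (Set.Icc 0 T ∩ N ⁻¹' {R}) :=
    isCompact_Icc.of_isClosed_subset hclosed Set.inter_subset_left
  obtain ⟨b, hb, hbR⟩ := hsub t ht hRt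
  obtain ⟨t₁, ⟨ht₁, hR⟩, hmin⟩ := hcomp.exists_isLeast ⟨b, ⟨hb.1, hb.2.trans ht.2⟩, hbR⟩
  refine (hstep t₁ ht₁ fun τ hτ => ?_).ne hR
  by_contra! hlt
  have hτT : τ ∈ Set.Icc 0 T := ⟨hτ.1, hτ.2.trans ht₁.2⟩
  obtain ⟨b', hb', hb'R⟩ := hsub τ hτT hlt.le
  have h1 := hmin ⟨⟨hb'.1, hb'.2.trans hτT.2⟩, hb'R⟩
  have h2 : τ = t₁ := le_antisymm hτ.2 (h1.trans hb'.2)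
  rw [h2] at hlt
  exact hlt.ne' hR

lemma exists_solution_of_bounded_lipschitz {E : Type*} [NormedAddCommGroup E] [NormedSpace ℝ E]
    [CompleteSpace E] {f : ℝ → E → E} {K L : NNReal} (hK : ∀ t, LipschitzWith K (f t))
    (hc : ∀ x, Continuous fun t => f t x) (hL : ∀ t x, ‖f t x‖ ≤ L) (x₀ : E) {T : ℝ}
    (hT : 0 ≤ T) :
    ∃ X : ℝ → E, X 0 = x₀ ∧
      ∀ t ∈ Set.Icc 0 T, HasDerivWithinAt X (f t (X t)) (Set.Icc 0 T) t := by
  have : IsPicardLindelof f (⟨0, le_rfl, hT⟩ : Set.Icc 0 T) x₀ (L * T.toNNReal) 0 L K :=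
    { lipschitzOnWith := fun t _ => (hK t).lipschitzOnWith
      continuousOn := fun x _ => (hc x).continuousOn
      norm_le := fun t _ x _ => hL t x
      mul_max_le := by simp [hT] }
  exact this.exists_eq_forall_mem_Icc_hasDerivWithinAt₀

/-- The unit vector of the heading angle `θ`. -/
def heading (θ : ℝ) : Plane := !₂[Real.cos θ, Real.sin θ]

lemma norm_heading (θ : ℝ) : ‖heading θ‖ = 1 := by
  rw [EuclideanSpace.norm_eq, heading]
  simp

lemma unicycleField_eq (C₁ C₂ c a Ω : ℝ) (Xd : Plane) (ε t : ℝ) (X : Plane) :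
    unicycleField C₁ C₂ c a Ω Xd ε t X =
      velocityLaw c a ε t (objective C₁ C₂ Xd X) • heading (Ω * t) := by
  ext i; fin_cases i <;> simp [unicycleField, heading]

/-- The closed loop with the measured objective cut off outside a ball has global solutions. -/
lemma exists_solution_cutoff (C₁ C₂ c a Ω : ℝ) (Xd : Plane) (R ε : ℝ) (X₀ : Plane) {T : ℝ}
    (hT : 0 ≤ T) :
    ∃ X : ℝ → Plane, X 0 = X₀ ∧ ContinuousOn X (Set.Icc 0 T) ∧ ∀ t₁ ∈ Set.Icc 0 T,
      ∀ t ∈ Set.Icc 0 t₁, ‖X t - Xd‖ ≤ R →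
        HasDerivWithinAt X (unicycleField C₁ C₂ c a Ω Xd ε t (X t)) (Set.Icc 0 t₁) t := by
  -- Equal to 1 on the ball of radius R; the absolute value keeps the radii positive for any real R.
  let χ : ContDiffBump Xd := ⟨|R| + 1, |R| + 2, by positivity, by linarith⟩
  let g : Plane → ℝ := fun X => χ X * objective C₁ C₂ Xd X
  have hJ : ContDiff ℝ 1 (objective C₁ C₂ Xd) := by
    unfold objective; fun_prop
  have hg : ContDiff ℝ 1 g := χ.contDiff.mul hJ
  have hgs : HasCompactSupport g := χ.hasCompactSupport.mul_right
  obtain ⟨Kg, hKg⟩ := hg.lipschitzWith_of_hasCompactSupport hgs one_ne_zero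
  obtain ⟨B, hB⟩ := hgs.exists_bound_of_continuous hg.continuous
  set A := 2 * (2 * Real.pi / ε) ^ (3 / 4 : ℝ) with hA
  let f : ℝ → Plane → Plane := fun t X => velocityLaw c a ε t (g X) • heading (Ω * t)
  have hfK : ∀ t, LipschitzWith (‖A * (3 * c)‖₊ * Kg) (f t) := by
    intro t
    refine LipschitzWith.of_dist_le_mul fun X Y => ?_
    simp only [f]
    rw [dist_eq_norm, ← sub_smul, norm_smul, norm_heading, mul_one, velocityLaw, velocityLaw,
      ← hA]
    have e : A * (3 * c * g X * Real.sin (6 * Real.pi * t / ε)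
        + a * Real.cos (2 * Real.pi * t / ε))
        - A * (3 * c * g Y * Real.sin (6 * Real.pi * t / ε)
        + a * Real.cos (2 * Real.pi * t / ε))
        = A * (3 * c) * (g X - g Y) * Real.sin (6 * Real.pi * t / ε) := by ring
    rw [e, Real.norm_eq_abs]
    refine abs_mul_le_of_abs_le_one ?_ (Real.abs_sin_le_one _)
    rw [abs_mul]
    push_cast
    rw [Real.norm_eq_abs, mul_assoc |A * (3 * c)|]
    exact mul_le_mul_of_nonneg_left (hKg.dist_le_mul X Y) (abs_nonneg _)
  have hfc : ∀ X, Continuous fun t => f t X := by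
    intro X
    refine Continuous.smul (f := fun t => velocityLaw c a ε t (g X))
      (g := fun t => heading (Ω * t)) ?_ ?_
    · unfold velocityLaw; fun_prop
    · unfold heading; fun_prop
  have hfL : ∀ t X, ‖f t X‖ ≤ (‖A‖₊ * (‖3 * c‖₊ * B.toNNReal + ‖a‖₊) : NNReal) := by
    intro t X
    simp only [f]
    rw [norm_smul, norm_heading, mul_one, velocityLaw, ← hA, norm_mul]
    push_cast
    gcongr
    refine (norm_add_le _ _).trans (add_le_add ?_ ?_)
    · refine abs_mul_le_of_abs_le_one ?_ (Real.abs_sin_le_one _)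
      rw [abs_mul]
      have : |g X| ≤ B.toNNReal := (hB X).trans (Real.le_coe_toNNReal B)
      rw [← Real.norm_eq_abs (3 * c)]
      gcongr
    · exact abs_mul_le_of_abs_le_one le_rfl (Real.abs_cos_le_one _)
  obtain ⟨X, hX0, hX⟩ := exists_solution_of_bounded_lipschitz hfK hfc hfL X₀ hT
  refine ⟨X, hX0, fun t ht => (hX t ht).continuousWithinAt, fun t₁ ht₁ t ht hR => ?_⟩
  have h := (hX t ⟨ht.1, ht.2.trans ht₁.2⟩).mono (Set.Icc_subset_Icc_right ht₁.2)
  refine h.congr_deriv ?_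
  rw [unicycleField_eq]
  have hχ : χ (X t) = 1 := χ.one_of_mem_closedBall (by
    rw [Metric.mem_closedBall, dist_eq_norm]
    show _ ≤ |R| + 1
    linarith [le_abs_self R])
  simp only [f, g, hχ, one_mul]

lemma norm_plane_le {X Y : Plane} {r : ℝ} (h0 : |X 0 - Y 0| ≤ r) (h1 : |X 1 - Y 1| ≤ r) :
    ‖X - Y‖ ≤ 2 * r := by
  have hr : 0 ≤ r := (abs_nonneg _).trans h0
  apply abs_le_of_sq_le_sq' _ (by positivity) |>.2
  rw [EuclideanSpace.real_norm_sq_eq, Fin.sum_univ_two]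
  simp only [PiLp.sub_apply]
  have := sq_le_sq' (abs_le.1 h0).1 (abs_le.1 h0).2
  have := sq_le_sq' (abs_le.1 h1).1 (abs_le.1 h1).2
  nlinarith

lemma abs_coord_le_norm (X : Plane) (i : Fin 2) : |X i| ≤ ‖X‖ := PiLp.norm_apply_le X i

/-! ### Scaling and the a priori estimate -/

/-- The amplitude scale `(ε / 2π)^(1/4)` of the near-identity transformation. -/
def ditherScale (ε : ℝ) : ℝ := (ε / (2 * Real.pi)) ^ (1 / 4 : ℝ)

lemma ditherScale_pos {ε : ℝ} (hε : 0 < ε) : 0 < ditherScale ε := by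
  unfold ditherScale; positivity

lemma ditherScale_inv_pow_four {ε : ℝ} (hε : 0 < ε) : (ditherScale ε)⁻¹ ^ 4 = 2 * Real.pi / ε := by
  have h : 0 ≤ ε / (2 * Real.pi) := by positivity
  rw [ditherScale, inv_pow, ← Real.rpow_natCast, ← Real.rpow_mul h]
  norm_num

lemma ditherScale_inv_pow_three {ε : ℝ} (hε : 0 < ε) :
    (ditherScale ε)⁻¹ ^ 3 = (2 * Real.pi / ε) ^ (3 / 4 : ℝ) := by
  have h : 0 ≤ ε / (2 * Real.pi) := by positivity
  rw [ditherScale, inv_pow, ← Real.rpow_natCast, ← Real.rpow_mul h, ← Real.inv_rpow h, inv_div]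
  norm_num

lemma tendsto_ditherScale : Tendsto ditherScale (𝓝[>] 0) (𝓝 0) := by
  have h : Continuous ditherScale := by
    unfold ditherScale
    exact (continuous_id.div_const _).rpow_const fun _ => Or.inr (by norm_num)
  have := h.tendsto 0
  rw [show ditherScale 0 = 0 by simp [ditherScale]] at this
  exact this.mono_left nhdsWithin_le_nhds

lemma velocityLaw_eq {c a ε t J : ℝ} (hε : 0 < ε) :
    velocityLaw c a ε t J = (ditherScale ε)⁻¹ ^ 3 * (6 * c *
      (3 * Real.sin ((ditherScale ε)⁻¹ ^ 4 * t) - 4 * Real.sin ((ditherScale ε)⁻¹ ^ 4 * t) ^ 3) * J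
      + 2 * a * Real.cos ((ditherScale ε)⁻¹ ^ 4 * t)) := by
  rw [← Real.sin_three_mul, ditherScale_inv_pow_three hε, ditherScale_inv_pow_four hε,
    velocityLaw, show 6 * Real.pi * t / ε = 3 * (2 * Real.pi / ε * t) by ring,
    show 2 * Real.pi * t / ε = 2 * Real.pi / ε * t by ring]
  ring

/-- A priori estimate for motions that stay in a bounded region; the decay constants do not depend
on the region. -/
theorem exists_apriori_estimate (C₁ C₂ c a Ω : ℝ) (hC₁ : 0 < C₁) (hC₂ : 0 < C₂) (hc : 0 < c)
    (ha : 0 < a) (hΩ : Ω ≠ 0) (Xd : Plane) :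
    ∃ q₁ > 0, ∃ q₂ > 0, ∀ R, ∃ K > 0, ∀ ε > 0, ditherScale ε ≤ 1 → ∀ (T : ℝ) (X : ℝ → Plane),
      (∀ t ∈ Set.Icc 0 T, ‖X t - Xd‖ ≤ R ∧
        HasDerivWithinAt X (unicycleField C₁ C₂ c a Ω Xd ε t (X t)) (Set.Icc 0 T) t) →
      ∀ t ∈ Set.Icc 0 T,
        ‖X t - Xd‖ ≤ q₁ * ‖X 0 - Xd‖ * Real.exp (-(q₂ * t)) + K * ditherScale ε := by
  obtain ⟨U, m, hm, M, hM, q, hq, KL, hKL, hUb, hU⟩ := exists_lyapunov (C₁ := C₁) (C₂ := C₂)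
    (lam := 6 * c * (2 * a) ^ 3 / 2) (Ω := Ω) hC₁ hC₂ (by positivity) hΩ
  -- Both constants come from the Lyapunov function alone, before R appears; the root and the half
  -- arise because it is quadratic in the norm.
  refine ⟨√(M / m), by positivity, q / 2, by positivity, fun R => ?_⟩
  obtain ⟨K, hK, hnear⟩ := exists_near_identity (6 * c) (2 * a) C₁ C₂ Ω R
  -- The summands account for the change of variables at time 0, the persistent error, and the
  -- change of variables at time t.
  refine ⟨√(M / m) * (2 * K) + √(KL / (q * m)) * K + 2 * K, by positivity,
    fun ε hε hδ1 T X hX t ht => ?_⟩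
  set δ := ditherScale ε with hδ
  have hδ0 : 0 < δ := ditherScale_pos hε
  obtain ⟨u, w, huw⟩ := hnear δ ⟨hδ0, hδ1⟩ (fun t => X t 0 - Xd 0) (fun t => X t 1 - Xd 1)
    (Set.Icc 0 T) (by
      intro τ hτ
      obtain ⟨hR, hd⟩ := hX τ hτ
      refine ⟨(abs_coord_le_norm (X τ - Xd) 0).trans hR, (abs_coord_le_norm (X τ - Xd) 1).trans hR,
        ?_, ?_⟩
      · have := ((EuclideanSpace.proj (𝕜 := ℝ) (0 : Fin 2)).hasFDerivAt
          (x := X τ)).comp_hasDerivWithinAt τ hd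
        refine (this.sub_const (Xd 0)).congr_deriv ?_
        simp [unicycleField, velocityLaw_eq hε, objective, hδ]
      · have := ((EuclideanSpace.proj (𝕜 := ℝ) (1 : Fin 2)).hasFDerivAt
          (x := X τ)).comp_hasDerivWithinAt τ hd
        refine (this.sub_const (Xd 1)).congr_deriv ?_
        simp [unicycleField, velocityLaw_eq hε, objective, hδ])
  let W : ℝ → Plane := fun τ => !₂[u τ, w τ]
  have hWsq (τ : ℝ) : u τ ^ 2 + w τ ^ 2 = ‖W τ‖ ^ 2 := by
    rw [EuclideanSpace.real_norm_sq_eq, Fin.sum_univ_two]; simp [W]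
  have hWX (τ : ℝ) (hτ : τ ∈ Set.Icc 0 T) : ‖W τ - (X τ - Xd)‖ ≤ 2 * (K * δ) := by
    obtain ⟨h1, h2, -⟩ := huw τ hτ
    exact norm_plane_le (by simpa [W] using h1) (by simpa [W] using h2)
  have hdecay := le_exp_decay_of_deriv_le (f := fun τ => U τ (u τ) (w τ)) (T := T) (q := q)
    (m := KL * (K * δ) ^ 2) hq (by positivity) (by
      intro τ hτ
      obtain ⟨-, -, e₁, e₂, he₁, he₂, hdu, hdw⟩ := huw τ hτ
      exact hU u w _ τ e₁ e₂ (K * δ) he₁ he₂ hdu hdw) ht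
  have h0 : (0 : ℝ) ∈ Set.Icc 0 T := ⟨le_rfl, ht.1.trans ht.2⟩
  have hlow := (hUb t (u t) (w t)).1
  have hup := (hUb 0 (u 0) (w 0)).2
  rw [hWsq] at hlow hup
  have hWt : ‖W t‖ ≤ √(M / m) * ‖W 0‖ * Real.exp (-(q / 2 * t)) + √(KL / (q * m)) * (K * δ) := by
    apply abs_le_of_sq_le_sq' _ (by positivity) |>.2
    have e1 : (√(M / m) * ‖W 0‖ * Real.exp (-(q / 2 * t))) ^ 2
        = M / m * ‖W 0‖ ^ 2 * Real.exp (-(q * t)) := by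
      rw [mul_pow, mul_pow, Real.sq_sqrt (by positivity), ← Real.exp_nat_mul]
      congr 2; push_cast; ring
    have e2 : (√(KL / (q * m)) * (K * δ)) ^ 2 = KL / (q * m) * (K * δ) ^ 2 := by
      rw [mul_pow, Real.sq_sqrt (by positivity)]
    have e3 : ‖W t‖ ^ 2 ≤ M / m * ‖W 0‖ ^ 2 * Real.exp (-(q * t))
        + KL / (q * m) * (K * δ) ^ 2 := by
      have := hlow.trans (hdecay.trans (add_le_add_left
        (mul_le_mul_of_nonneg_right hup (Real.exp_pos _).le) _))
      rw [← mul_le_mul_iff_right₀ hm]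
      refine this.trans (le_of_eq ?_)
      field_simp
    have e4 : 0 ≤ (√(M / m) * ‖W 0‖ * Real.exp (-(q / 2 * t))) * (√(KL / (q * m)) * (K * δ)) := by
      positivity
    rw [add_sq, e1, e2]
    linarith
  have hXt : ‖X t - Xd‖ ≤ ‖W t‖ + 2 * (K * δ) := by
    have := norm_sub_norm_le (X t - Xd) (W t)
    rw [norm_sub_rev (X t - Xd)] at this
    linarith [hWX t ht]
  have hW0 : ‖W 0‖ ≤ ‖X 0 - Xd‖ + 2 * (K * δ) := by
    linarith [norm_sub_norm_le (W 0) (X 0 - Xd), hWX 0 h0]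
  have hexp : Real.exp (-(q / 2 * t)) ≤ 1 := by
    rw [Real.exp_le_one_iff]
    have := ht.1
    have : 0 ≤ q / 2 * t := by positivity
    linarith
  have hfirst : √(M / m) * ‖W 0‖ * Real.exp (-(q / 2 * t))
      ≤ √(M / m) * ‖X 0 - Xd‖ * Real.exp (-(q / 2 * t)) + √(M / m) * (2 * (K * δ)) := by
    calc √(M / m) * ‖W 0‖ * Real.exp (-(q / 2 * t))
        ≤ √(M / m) * (‖X 0 - Xd‖ + 2 * (K * δ)) * Real.exp (-(q / 2 * t)) := by gcongr
      _ = √(M / m) * ‖X 0 - Xd‖ * Real.exp (-(q / 2 * t))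
          + √(M / m) * (2 * (K * δ)) * Real.exp (-(q / 2 * t)) := by ring
      _ ≤ _ := by
        exact add_le_add_right (mul_le_of_le_one_right (by positivity) hexp) _
  linarith

end

/-! ### Closing the bootstrap -/

theorem theorem2 (C₁ C₂ c a Ω : ℝ) (hC₁ : 0 < C₁) (hC₂ : 0 < C₂) (hc : 0 < c) (ha : 0 < a)
    (hΩ : Ω ≠ 0) (Xd : Plane) (D : Set Plane) (hD : IsCompact D) (hXd : Xd ∈ D) :
    IsPracticallyExpStable (unicycleField C₁ C₂ c a Ω Xd) Xd D := by
  obtain ⟨q₁, hq₁, q₂, hq₂, hest⟩ := exists_apriori_estimate C₁ C₂ c a Ω hC₁ hC₂ hc ha hΩ Xd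
  obtain ⟨r, hr⟩ := hD.isBounded.subset_closedBall Xd
  have hr0 : 0 ≤ r := by simpa using hr hXd
  -- Exceeds both the initial distance and q₁r plus the residual, which is below 1 for small ε.
  set R := q₁ * r + r + 1 with hR
  obtain ⟨K, hK, hK'⟩ := hest R
  have hlim : Tendsto (fun ε => K * ditherScale ε) (𝓝[>] 0) (𝓝 0) := by
    simpa using tendsto_ditherScale.const_mul K
  have hev : ∀ᶠ ε in 𝓝[>] (0 : ℝ), ditherScale ε < 1 ∧ K * ditherScale ε < 1 :=
    (tendsto_ditherScale.eventually_lt_const one_pos).and (hlim.eventually_lt_const one_pos)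
  obtain ⟨ε₀, hε₀, hsub⟩ := mem_nhdsGT_iff_exists_Ioo_subset.1 hev
  refine ⟨q₁, hq₁, q₂, hq₂, fun ε => K * ditherScale ε, hlim, ε₀, hε₀, ?_⟩
  intro ε hε X₀ hX₀ T hT
  obtain ⟨hδ1, hKδ⟩ := hsub hε
  have hX₀r : ‖X₀ - Xd‖ ≤ r := by simpa [dist_eq_norm] using hr hX₀
  -- The equation is required only inside the ball, so this covers true solutions as well as those
  -- of the cut-off system, which are thereby true solutions.
  have confined : ∀ X : ℝ → Plane, X 0 = X₀ → ContinuousOn X (Set.Icc 0 T) →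
      (∀ t₁ ∈ Set.Icc 0 T, ∀ t ∈ Set.Icc 0 t₁, ‖X t - Xd‖ ≤ R →
        HasDerivWithinAt X (unicycleField C₁ C₂ c a Ω Xd ε t (X t)) (Set.Icc 0 t₁) t) →
      ∀ t ∈ Set.Icc 0 T, ‖X t - Xd‖ < R := by
    intro X h0 hcont hder
    have hq₁r : 0 ≤ q₁ * r := by positivity
    refine confined_of_first_exit (N := fun t => ‖X t - Xd‖) (by fun_prop) ?_ ?_
    · rw [h0]; linarith
    · intro t₁ ht₁ hle
      have := hK' ε hε.1 hδ1.le t₁ X (fun t ht => ⟨hle t ht, hder t₁ ht₁ t ht (hle t ht)⟩) t₁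
        ⟨ht₁.1, le_rfl⟩
      rw [h0] at this
      have hexp : Real.exp (-(q₂ * t₁)) ≤ 1 := by
        rw [Real.exp_le_one_iff]
        linarith [mul_nonneg hq₂.le ht₁.1]
      have : q₁ * ‖X₀ - Xd‖ * Real.exp (-(q₂ * t₁)) ≤ q₁ * r := by
        refine (mul_le_of_le_one_right (by positivity) hexp).trans ?_
        gcongr
      linarith
  constructor
  · obtain ⟨X, h0, hcont, hder⟩ := exists_solution_cutoff C₁ C₂ c a Ω Xd R ε X₀ hT.le
    refine ⟨X, h0, fun t ht => ?_⟩
    exact hder T ⟨hT.le, le_rfl⟩ t ht (confined X h0 hcont hder t ht).le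
  · rintro X ⟨h0, hX⟩ t ht
    have hcon := confined X h0 (fun t ht => (hX t ht).continuousWithinAt)
      (fun t₁ ht₁ t ht _ => (hX t ⟨ht.1, ht.2.trans ht₁.2⟩).mono
        (Set.Icc_subset_Icc_right ht₁.2))
    have := hK' ε hε.1 hδ1.le T X (fun t ht => ⟨(hcon t ht).le, hX t ht⟩) t ht
    rwa [h0] at this
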